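/- Let $q=p^{\alpha}$, where $p\equiv 1\pmod 8$ is a prime and $\alpha\ge 1$ is an integer. Let $g$ be a generator of the cyclic group $\mathbb{Z}_q^{\ast}$ of units of $\mathbb{Z}_q=\mathbb{Z}/q\mathbb{Z}$, and let $G^{\ast}(q)$ be the Peisert-like graph: its vertex set is $\mathbb{Z}_q$, and $x,y$ are adjacent if and only if $x-y\in\langle g^4\rangle\cup g\langle g^4\rangle$. Let $k_4(G^{\ast}(q))$ be the number of cliques of order $4$ (sets of four pairwise adjacent vertices) in $G^{\ast}(q)$. For Dirichlet characters $A,B$ mod $q$ let $J(A,B)=\sum_{x\in\mathbb{Z}_q}A(x)B(1-x)$ be the Jacobi sum and put $\binom{A}{B}=\frac{B(-1)}{q}J(A,\overline{B})$. For Dirichlet characters $A_0,\dots,A_n,B_1,\dots,B_n$ mod $q$ and $x\in\mathbb{Z}_q$ define $$ {}_{n+1}F_n\left(\begin{matrix}A_0,&A_1,&\dots,&A_n\\&B_1,&\dots,&B_n\end{matrix}\,\Big|\,x\right)=\frac{q}{\phi(q)}\sum_{\chi}\binom{A_0\chi}{\chi}\binom{A_1\chi}{B_1\chi}\cdots\binom{A_n\chi}{B_n\chi}\chi(x),$$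 where $\chi$ runs over all Dirichlet characters mod $q$ and $\phi$ is Euler's totient function. Let $\chi_4$ be a Dirichlet character mod $q$ of order $4$, and let $\varphi$ and $\varepsilon$ be the quadratic character (the character of order $2$) and the trivial character mod $q$. Let $\rho=J(\chi_4,\chi_4)$, $\xi=J(\chi_4,\varphi)$, $$M_3=q^2\cdot{}_3F_2\left(\begin{matrix}\chi_4,&\overline{\chi_4},&\overline{\chi_4}\\&\varphi,&\varepsilon\end{matrix}\,\Big|\,1\right),\qquad M_5=q^2\cdot{}_3F_2\left(\begin{matrix}\chi_4,&\chi_4,&\overline{\chi_4}\\&\varepsilon,&\varepsilon\end{matrix}\,\Big|\,1\right).$$ Then $$k_4(G^{\ast}(q))=\frac{p^{2\alpha-1}(p-1)}{3072}\Big[2p^{2\alpha-2}(p^2-20p+81)+2\,\mathrm{Im}(\rho)^2+4\,\mathrm{Im}(\rho)\,\mathrm{Im}(\xi)-\mathrm{Re}(M_3)+3M_5\Big].$$ -/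

import Mathlib

noncomputable section

/-- The subset `⟨g⁴⟩ ∪ g⟨g⁴⟩` of `ℤ/n`, for a unit `g` of `ℤ/n`. -/
def peisertConnectionSet {n : ℕ} (g : (ZMod n)ˣ) : Set (ZMod n) :=
  {x | ∃ u ∈ Subgroup.zpowers (g ^ 4), x = (u : ZMod n) ∨ x = (g : ZMod n) * (u : ZMod n)}

/-- The Peisert-like graph on the vertex set `ℤ/n` attached to a unit `g` (meant to be a generator
of the unit group): `x` and `y` are adjacent iff `x - y ∈ ⟨g⁴⟩ ∪ g⟨g⁴⟩`. The symmetrization and the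
exclusion of loops that are built into `SimpleGraph.circulantGraph` have no effect for the moduli
of interest, see `peisertLikeGraph_adj`. -/
def peisertLikeGraph {n : ℕ} (g : (ZMod n)ˣ) : SimpleGraph (ZMod n) :=
  SimpleGraph.circulantGraph (peisertConnectionSet g)

/-- For `n = p ^ α` with `p ≡ 1 (mod 8)` and `g` a generator of the unit group, adjacency in the
Peisert-like graph is exactly `x - y ∈ ⟨g⁴⟩ ∪ g⟨g⁴⟩`. -/
theorem peisertLikeGraph_adj {p α : ℕ} [Fact p.Prime] (hp : p % 8 = 1) (hα : 1 ≤ α)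
    (g : (ZMod (p ^ α))ˣ) (hg : ∀ u : (ZMod (p ^ α))ˣ, u ∈ Subgroup.zpowers g)
    (x y : ZMod (p ^ α)) :
    (peisertLikeGraph g).Adj x y ↔ x - y ∈ peisertConnectionSet g := by
  have hprime : p.Prime := Fact.out
  have hneg : (-1 : (ZMod (p ^ α))ˣ) ∈ Subgroup.zpowers (g ^ 4) := by
    obtain ⟨k, hk⟩ := Subgroup.mem_zpowers_iff.1 (hg (-1))
    have hcard : orderOf g = Nat.totient (p ^ α) := by
      rw [orderOf_eq_card_of_forall_mem_zpowers hg, Nat.card_eq_fintype_card,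
        ZMod.card_units_eq_totient]
    have h8 : 8 ∣ orderOf g := by
      rw [hcard, Nat.totient_prime_pow hprime hα]
      exact Dvd.dvd.mul_left (by omega) _
    have h1 : g ^ (k * 2) = 1 := by
      rw [zpow_mul, hk]
      simp
    have h2 : (orderOf g : ℤ) ∣ k * 2 := orderOf_dvd_iff_zpow_eq_one.2 h1
    have h3 : (8 : ℤ) ∣ k * 2 := dvd_trans (by exact_mod_cast h8) h2
    obtain ⟨m, rfl⟩ : (4 : ℤ) ∣ k := by omega
    refine Subgroup.mem_zpowers_iff.2 ⟨m, ?_⟩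
    rw [← hk, zpow_mul]
    norm_cast
  have hsymm : ∀ z : ZMod (p ^ α), z ∈ peisertConnectionSet g → -z ∈ peisertConnectionSet g := by
    rintro z ⟨u, hu, h⟩
    refine ⟨-1 * u, Subgroup.mul_mem _ hneg hu, ?_⟩
    rcases h with rfl | rfl <;> simp
  have hq : 1 < p ^ α := Nat.one_lt_pow (by omega) hprime.one_lt
  have : Fact (1 < p ^ α) := ⟨hq⟩
  have hzero : (0 : ZMod (p ^ α)) ∉ peisertConnectionSet g := by
    rintro ⟨u, -, h | h⟩
    · exact u.ne_zero h.symm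
    · exact (g * u).ne_zero (by rw [Units.val_mul]; exact h.symm)
  rw [peisertLikeGraph, SimpleGraph.circulantGraph_adj]
  constructor
  · rintro ⟨-, h | h⟩
    · exact h
    · simpa using hsymm _ h
  · intro h
    refine ⟨?_, Or.inl h⟩
    rintro rfl
    exact hzero (by simpa using h)

/-- The binomial coefficient of two Dirichlet characters mod `q`: `(B(-1)/q) J(A, B̄)`, where
`J(A, B) = ∑ x : ℤ/q, A(x) B(1 - x)` is `jacobiSum A B`, and the complex conjugate character of `B`
is its inverse `B⁻¹` (`MulChar.star_eq_inv`). -/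
def dirichletBinom {q : ℕ} [NeZero q] (A B : DirichletCharacter ℂ q) : ℂ :=
  B (-1) / (q : ℂ) * jacobiSum A B⁻¹

/-- The hypergeometric function `_{n+1}F_n` of Dirichlet characters `A₀, A₁, …, Aₙ` and
`B₁, …, Bₙ` mod `q`, evaluated at `x : ℤ/q`; the sum is over all Dirichlet characters mod `q`. -/
def dirichletHypergeometric {q : ℕ} [NeZero q] {n : ℕ} (A₀ : DirichletCharacter ℂ q)
    (A B : Fin n → DirichletCharacter ℂ q) (x : ZMod q) : ℂ :=
  (q : ℂ) / (Nat.totient q : ℂ) *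
    ∑ χ : DirichletCharacter ℂ q,
      dirichletBinom (A₀ * χ) χ * (∏ i : Fin n, dirichletBinom (A i * χ) (B i * χ)) * χ x

end

/-! Twenty-four times the clique count is the sum over quadruples of the edge indicator multiplied
over the six differences. The indicator factors through reduction mod p: a character of order 4 is
trivial on the p-group of units congruent to 1 mod p (`exists_mulChar_of_coprime_order`). So it
suffices to work over the field with p elements and to restore powers of p, one for each fibre of
the reduction.

Over the field the indicator is (1 + c)/2 away from 0, where c = ((1 - ω)χ + (1 + ω)χ⁻¹)/2 with ω =
χ(g) is an even function with values ±1. Expand the product of 1 + c over the edges of K₄. Subgraphs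
with an odd number of edges cancel, because multiplication by g² negates c. Those with two or four
edges have elementary sums, except that the four-cycle brings in the self-convolution of c, hence Im
J(χ,χ)² (`distinctSum_completeTerm_one_add`). The full K₄ term is expanded again in χ and χ⁻¹;
averaging over ω and -ω leaves only multiples of `triangleSum` and `pathSum`
(`sum_completeTerm_quarticSign`).

Orthogonality of characters identifies M₃ and M₅ with these double sums
(`dirichletHypergeometric_three_two`). Finally ξ = ρ, because J(χ,χ) = J(χ,χ²) when χ(4) = 1
(`jacobiSum_self_eq`), so the two imaginary-part terms together are 6 Im(ρ)². -/

section Quadruples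

/-! ### Sums over quadruples and relabelling of their entries. -/

variable {F : Type*} [Fintype F]

theorem sum_fin_four_eq (f : F → F → F → F → ℂ) :
    ∑ v : Fin 4 → F, f (v 0) (v 1) (v 2) (v 3) = ∑ a, ∑ b, ∑ x, ∑ y, f a b x y := by
  let e : (Fin 4 → F) ≃ F × F × F × F :=
    { toFun := fun v => (v 0, v 1, v 2, v 3)
      invFun := fun t => ![t.1, t.2.1, t.2.2.1, t.2.2.2]
      left_inv := fun v => by ext i; fin_cases i <;> rfl
      right_inv := fun t => rfl }
  refine (Fintype.sum_equiv e _ (fun t => f t.1 t.2.1 t.2.2.1 t.2.2.2) fun v => rfl).trans ?_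
  simp only [Fintype.sum_prod_type]

theorem sum_fin_four_perm {i j k l : Fin 4} (h : Function.Injective ![i, j, k, l])
    (f : F → F → F → F → ℂ) :
    ∑ v : Fin 4 → F, f (v i) (v j) (v k) (v l) = ∑ a, ∑ b, ∑ x, ∑ y, f a b x y := by
  rw [← sum_fin_four_eq]
  let σ : Equiv.Perm (Fin 4) := Equiv.ofBijective _ (Finite.injective_iff_bijective.1 h)
  exact Fintype.sum_equiv (σ.symm.arrowCongr (Equiv.refl F)) _ _ (fun v => rfl)

end Quadruples

/-! ### Sums over distinct points. -/

section DistinctPoints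

variable {F : Type*} [Field F] [DecidableEq F]

/-- The indicator function of the nonzero elements. -/
def nonzeroInd (x : F) : ℂ := if x = 0 then 0 else 1

theorem nonzeroInd_mul_self (x : F) : nonzeroInd x * nonzeroInd x = nonzeroInd x := by
  unfold nonzeroInd; split_ifs <;> simp

theorem nonzeroInd_neg (x : F) : nonzeroInd (-x) = nonzeroInd x := by
  simp [nonzeroInd]

/-- The indicator function of the quadruples of distinct elements. -/
def distinctInd (a b x y : F) : ℂ :=
  nonzeroInd (a - b) * (nonzeroInd (a - x) * nonzeroInd (b - x)) *
    (nonzeroInd (a - y) * nonzeroInd (b - y) * nonzeroInd (x - y))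

theorem distinctInd_eq (a b x y : F) :
    distinctInd a b x y = if Function.Injective ![a, b, x, y] then 1 else 0 := by
  have h : Function.Injective ![a, b, x, y] ↔
      a ≠ b ∧ a ≠ x ∧ b ≠ x ∧ a ≠ y ∧ b ≠ y ∧ x ≠ y := by
    simp only [Function.Injective, Fin.forall_fin_succ]
    simp
    grind
  simp only [h, distinctInd, nonzeroInd, sub_eq_zero]
  by_cases h1 : a = b <;> by_cases h2 : a = x <;> by_cases h3 : b = x <;> by_cases h4 : a = y <;>
    by_cases h5 : b = y <;> by_cases h6 : x = y <;> simp [h1, h2, h3, h4, h5, h6]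

theorem distinctInd_perm {i j k l : Fin 4} (h : Function.Injective ![i, j, k, l])
    (v : Fin 4 → F) :
    distinctInd (v i) (v j) (v k) (v l) = distinctInd (v 0) (v 1) (v 2) (v 3) := by
  have h1 : ![v i, v j, v k, v l] = v ∘ ![i, j, k, l] := by
    ext t; fin_cases t <;> rfl
  have h2 : ![v 0, v 1, v 2, v 3] = v := by
    ext t; fin_cases t <;> rfl
  have h3 : Function.Injective (v ∘ ![i, j, k, l]) ↔ Function.Injective v :=
    Function.Injective.of_comp_iff' v (Finite.injective_iff_bijective.1 h)
  rw [distinctInd_eq, distinctInd_eq, h1, h2]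
  simp only [h3]

variable [Fintype F]

theorem sum_distinct_perm {i j k l : Fin 4} (h : Function.Injective ![i, j, k, l])
    (f : F → F → F → F → ℂ) :
    ∑ v : Fin 4 → F, distinctInd (v 0) (v 1) (v 2) (v 3) * f (v i) (v j) (v k) (v l) =
      ∑ a, ∑ b, ∑ x, ∑ y, distinctInd a b x y * f a b x y := by
  rw [← sum_fin_four_perm h]
  exact Finset.sum_congr rfl fun v _ => by rw [distinctInd_perm h]

theorem sum_ne (a : F) (f : F → ℂ) :
    ∑ b, nonzeroInd (a - b) * f b = ∑ b, f b - f a := by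
  have h : ∀ b, nonzeroInd (a - b) * f b = f b - if a = b then f b else 0 := by
    intro b
    simp only [nonzeroInd, sub_eq_zero]
    split_ifs <;> simp
  simp only [h, Finset.sum_sub_distrib, Finset.sum_ite_eq, Finset.mem_univ, if_true]

theorem sum_ne_ne {a b : F} (hab : a ≠ b) (f : F → ℂ) :
    ∑ x, nonzeroInd (a - x) * nonzeroInd (b - x) * f x = ∑ x, f x - f a - f b := by
  simp only [mul_assoc]
  rw [sum_ne, sum_ne]
  simp only [nonzeroInd, sub_eq_zero, hab.symm, if_false]
  ring

theorem sum_ne_ne_ne {a b x : F} (hab : a ≠ b) (hax : a ≠ x) (hbx : b ≠ x) (f : F → ℂ) :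
    ∑ y, nonzeroInd (a - y) * nonzeroInd (b - y) * nonzeroInd (x - y) * f y =
      ∑ y, f y - f a - f b - f x := by
  simp only [mul_assoc _ (nonzeroInd (_ - _)) (f _)]
  rw [sum_ne_ne hab, sum_ne]
  simp only [nonzeroInd, sub_eq_zero, hax.symm, hbx.symm, if_false]
  ring

/-- Evaluation from the inside out: each inner sum is a full sum minus its values at the excluded
points. `f₁` and `f₂` are the closed forms found in turn. -/
theorem sum_distinct_of_inner (f : F → F → F → F → ℂ) (f₁ : F → F → F → ℂ) (f₂ : F → F → ℂ)
    (h₁ : ∀ a b x, a ≠ b → a ≠ x → b ≠ x →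
      ∑ y, f a b x y - f a b x a - f a b x b - f a b x x = f₁ a b x)
    (h₂ : ∀ a b, a ≠ b → ∑ x, f₁ a b x - f₁ a b a - f₁ a b b = f₂ a b) :
    ∑ a, ∑ b, ∑ x, ∑ y, distinctInd a b x y * f a b x y =
      ∑ a, ∑ b, nonzeroInd (a - b) * f₂ a b := by
  refine Finset.sum_congr rfl fun a _ => Finset.sum_congr rfl fun b _ => ?_
  by_cases hab : a = b
  · simp [distinctInd, nonzeroInd, hab]
  rw [← h₂ a b hab, ← sum_ne_ne hab, Finset.mul_sum]
  refine Finset.sum_congr rfl fun x _ => ?_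
  by_cases hax : a = x
  · simp [distinctInd, nonzeroInd, hax]
  by_cases hbx : b = x
  · simp [distinctInd, nonzeroInd, hbx]
  rw [← h₁ a b x hab hax hbx, ← sum_ne_ne_ne hab hax hbx, Finset.mul_sum, Finset.mul_sum]
  refine Finset.sum_congr rfl fun y _ => ?_
  unfold distinctInd
  ring

end DistinctPoints

/-! ### Subgraph expansion for an even sign function with sum zero. -/

section SignFunction

variable {F : Type*} [Field F] [Fintype F]

theorem sum_const_sub_left (f : F → ℂ) (a : F) : ∑ x, f (a - x) = ∑ x, f x :=
  Fintype.sum_equiv (Equiv.subLeft a) _ _ fun _ => rfl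

theorem sum_sub_const_right (f : F → ℂ) (a : F) : ∑ x, f (x - a) = ∑ x, f x :=
  Fintype.sum_equiv (Equiv.subRight a) _ _ fun _ => rfl

variable [DecidableEq F]

/-- The sum of a function over all quadruples of distinct elements. -/
def distinctSum (f : F → F → F → F → ℂ) : ℂ :=
  ∑ a, ∑ b, ∑ x, ∑ y, distinctInd a b x y * f a b x y

theorem sum_nonzeroInd : ∑ x : F, nonzeroInd x = (Fintype.card F : ℂ) - 1 := by
  have := sum_ne (0 : F) (fun _ => 1)
  simpa [nonzeroInd_neg] using this

theorem distinctSum_one :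
    distinctSum (fun _ _ _ _ : F => (1 : ℂ)) =
      Fintype.card F * (Fintype.card F - 1) * ((Fintype.card F - 2) * (Fintype.card F - 3)) := by
  rw [distinctSum, sum_distinct_of_inner _ (fun _ _ _ => (Fintype.card F : ℂ) - 3)
    (fun _ _ => ((Fintype.card F : ℂ) - 2) * (Fintype.card F - 3))]
  · simp only [← Finset.sum_mul, sum_const_sub_left nonzeroInd, sum_nonzeroInd]
    simp only [Finset.sum_const, Finset.card_univ, nsmul_eq_mul]
  · intros; simp; ring
  · intros; simp; ring

variable {c : F → ℂ} (hneg : ∀ x, c (-x) = c x) (hsq : ∀ x, c x * c x = nonzeroInd x)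
  (hsum : ∑ x, c x = 0)

include hsq in
omit [Fintype F] in
theorem signFun_zero : c 0 = 0 := by
  simpa [nonzeroInd] using hsq 0

include hneg in
omit [Fintype F] [DecidableEq F] in
theorem signFun_sub_comm (a b : F) : c (a - b) = c (b - a) := by
  rw [← hneg, neg_sub]

include hneg hsq hsum in
theorem distinctSum_adjacent :
    distinctSum (fun a b x _ => c (a - b) * c (b - x)) =
      Fintype.card F * (Fintype.card F - 1) * (3 - Fintype.card F) := by
  rw [distinctSum, sum_distinct_of_inner _
    (fun a b x => ((Fintype.card F : ℂ) - 3) * (c (a - b) * c (b - x)))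
    (fun a b => (3 - (Fintype.card F : ℂ)) * (c (a - b) * c (a - b)))]
  · simp only [hsq, mul_left_comm (nonzeroInd _), nonzeroInd_mul_self, ← Finset.mul_sum,
      sum_const_sub_left nonzeroInd, sum_nonzeroInd]
    simp
    ring
  · intros; simp; ring
  · intro a b _
    simp only [← Finset.mul_sum, sum_const_sub_left c, hsum, sub_self, signFun_zero hsq,
      signFun_sub_comm hneg b a]
    ring

include hneg hsq hsum in
theorem distinctSum_opposite :
    distinctSum (fun a b x y => c (a - b) * c (x - y)) =
      Fintype.card F * (Fintype.card F - 1) * 2 := by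
  rw [distinctSum, sum_distinct_of_inner _
    (fun a b x => -(c (a - b) * (c (x - a) + c (x - b))))
    (fun a b => 2 * (c (a - b) * c (a - b)))]
  · simp only [hsq, mul_left_comm (nonzeroInd _), nonzeroInd_mul_self, ← Finset.mul_sum,
      sum_const_sub_left nonzeroInd, sum_nonzeroInd]
    simp
    ring
  · intro a b x _ _ _
    simp only [← Finset.mul_sum, sum_const_sub_left c, hsum, sub_self, signFun_zero hsq]
    ring
  · intro a b _
    simp only [Finset.sum_neg_distrib, ← Finset.mul_sum, Finset.sum_add_distrib,
      sum_sub_const_right c, hsum, sub_self, signFun_zero hsq, signFun_sub_comm hneg b a]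
    ring

include hneg hsq hsum in
-- The full sum over the pendant vertex y vanishes, so only the excluded values y = b and y = x
-- contribute; each doubles an edge, and the square of c is 1 there.
theorem distinctSum_paw :
    distinctSum (fun a b x y => c (a - b) * c (b - x) * c (x - a) * c (a - y)) =
      Fintype.card F * (Fintype.card F - 1) * 2 := by
  rw [distinctSum, sum_distinct_of_inner _
    (fun a b x => -(nonzeroInd (a - b) * (c (b - x) * c (x - a)))
      - c (a - b) * (nonzeroInd (a - x) * c (b - x)))
    (fun a b => c (a - b) * c (a - b) - ∑ x, c (b - x) * c (x - a))]
  · have h : ∀ a : F, ∑ b, nonzeroInd (a - b) * (c (a - b) * c (a - b)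
        - ∑ x, c (b - x) * c (x - a)) = 2 * ((Fintype.card F : ℂ) - 1) := by
      intro a
      have h1 : ∑ b, ∑ x, c (b - x) * c (x - a) = 0 := by
        rw [Finset.sum_comm]
        simp only [← Finset.sum_mul, sum_sub_const_right c, hsum, zero_mul, Finset.sum_const_zero]
      have h2 : ∑ x, c (a - x) * c (x - a) = (Fintype.card F : ℂ) - 1 := by
        simp only [signFun_sub_comm hneg a, hsq, sum_sub_const_right nonzeroInd, sum_nonzeroInd]
      simp only [mul_sub, Finset.sum_sub_distrib]
      rw [sum_ne a (fun b => ∑ x, c (b - x) * c (x - a)), h1, h2]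
      simp only [hsq, nonzeroInd_mul_self, sum_const_sub_left nonzeroInd, sum_nonzeroInd]
      ring
    simp only [h]
    simp
    ring
  · intro a b x _ _ _
    simp only [← Finset.mul_sum, sum_const_sub_left c, hsum, sub_self, signFun_zero hsq]
    rw [signFun_sub_comm hneg x a, ← hsq (a - b), ← hsq (a - x)]
    ring
  · intro a b hab
    have h1 : nonzeroInd (a - b) = 1 := by simp [nonzeroInd, sub_eq_zero, hab]
    have h0 : nonzeroInd (0 : F) = 0 := by simp [nonzeroInd]
    simp only [Finset.sum_sub_distrib, Finset.sum_neg_distrib, ← Finset.mul_sum,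
      sum_ne a fun x => c (b - x), sum_const_sub_left c, hsum, sub_self, signFun_zero hsq, h1, h0]
    rw [signFun_sub_comm hneg b a]
    ring

include hneg hsq in
-- Here a and b are opposite corners, so the sums over x and over y are both the convolution of c at
-- a - b. Squaring it gives β²; the part linear in ψ dies because ψ has sum zero.
theorem distinctSum_cycle {ψ : F → ℂ} {β : ℂ} (hψsq : ∀ x, ψ x * ψ x = nonzeroInd x)
    (hψsum : ∑ x, ψ x = 0)
    (hconv : ∀ a b, a ≠ b → ∑ x, c (a - x) * c (x - b) = β * ψ (a - b) - 1) :
    distinctSum (fun a b x y => c (a - x) * c (x - b) * c (b - y) * c (y - a)) =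
      Fintype.card F * (Fintype.card F - 1) * (β ^ 2 + 3 - Fintype.card F) := by
  rw [distinctSum, sum_distinct_of_inner _
    (fun a b x => (β * ψ (a - b) - 1) * (c (a - x) * c (x - b))
      - nonzeroInd (a - x) * nonzeroInd (b - x))
    (fun a b => β ^ 2 * (ψ (a - b) * ψ (a - b)) + (-2 * β * ψ (a - b) + (3 - Fintype.card F)))]
  · have h : ∀ a : F, ∑ b, nonzeroInd (a - b) * (β ^ 2 * (ψ (a - b) * ψ (a - b))
        + (-2 * β * ψ (a - b) + (3 - (Fintype.card F : ℂ)))) =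
        ((Fintype.card F : ℂ) - 1) * (β ^ 2 + 3 - Fintype.card F) := by
      intro a
      rw [sum_ne, sum_const_sub_left
        (fun u => β ^ 2 * (ψ u * ψ u) + (-2 * β * ψ u + (3 - (Fintype.card F : ℂ))))]
      simp only [Finset.sum_add_distrib, ← Finset.mul_sum, hψsq, sum_nonzeroInd, hψsum,
        sub_self, signFun_zero hψsq]
      simp
      ring
    simp only [h]
    simp
    ring
  · intro a b x hab hax hbx
    have h1 : ∑ y, c (b - y) * c (y - a) = β * ψ (a - b) - 1 := by
      rw [← hconv a b hab]
      exact Finset.sum_congr rfl fun y _ => by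
        rw [signFun_sub_comm hneg b, signFun_sub_comm hneg a, mul_comm]
    simp only [mul_assoc (c (a - x) * c (x - b)), ← Finset.mul_sum, h1, sub_self, signFun_zero hsq]
    rw [← hsq (a - x), ← hsq (b - x), signFun_sub_comm hneg x b, signFun_sub_comm hneg x a]
    ring
  · intro a b hab
    simp only [Finset.sum_sub_distrib, ← Finset.mul_sum, hconv a b hab, sub_self, signFun_zero hsq]
    have h1 := sum_ne_ne hab (fun _ => 1)
    simp only [mul_one] at h1
    rw [h1]
    simp [nonzeroInd]
    ring

/-- A product of values of `c` along two adjacent edges. -/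
def adjacentTerm (c : F → ℂ) (a b x _y : F) : ℂ := c (a - b) * c (b - x)

/-- A product of values of `c` along two opposite edges. -/
def oppositeTerm (c : F → ℂ) (a b x y : F) : ℂ := c (a - b) * c (x - y)

/-- A product of values of `c` along a triangle with a pendant edge. -/
def pawTerm (c : F → ℂ) (a b x y : F) : ℂ := c (a - b) * c (b - x) * c (x - a) * c (a - y)

/-- A product of values of `c` along a cycle of length four. -/
def cycleTerm (c : F → ℂ) (a b x y : F) : ℂ := c (a - x) * c (x - b) * c (b - y) * c (y - a)

/-- The product of the values of `c` along all six edges. -/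
def completeTerm (c : F → ℂ) (a b x y : F) : ℂ :=
  c (a - b) * c (a - x) * c (a - y) * c (b - x) * c (b - y) * c (x - y)

include hneg in
omit [Fintype F] [DecidableEq F] in
-- Only the 32 subgraphs of K₄ with an even number of edges survive: the empty one, 12 + 3 pairs of
-- edges, their complements (12 paws and 3 four-cycles), and K₄.
theorem completeTerm_one_add_add_one_sub (v : Fin 4 → F) :
    completeTerm (fun x => 1 + c x) (v 0) (v 1) (v 2) (v 3) +
        completeTerm (fun x => 1 - c x) (v 0) (v 1) (v 2) (v 3) =
      2 * (1 + (adjacentTerm c (v 0) (v 1) (v 2) (v 3) + adjacentTerm c (v 0) (v 1) (v 3) (v 2) +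
      adjacentTerm c (v 0) (v 2) (v 1) (v 3) + adjacentTerm c (v 0) (v 2) (v 3) (v 1) +
      adjacentTerm c (v 0) (v 3) (v 1) (v 2) + adjacentTerm c (v 0) (v 3) (v 2) (v 1) +
      adjacentTerm c (v 1) (v 0) (v 2) (v 3) + adjacentTerm c (v 1) (v 0) (v 3) (v 2) +
      adjacentTerm c (v 1) (v 2) (v 3) (v 0) + adjacentTerm c (v 1) (v 3) (v 2) (v 0) +
      adjacentTerm c (v 2) (v 0) (v 3) (v 1) + adjacentTerm c (v 2) (v 1) (v 3) (v 0)) +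
      (oppositeTerm c (v 0) (v 1) (v 2) (v 3) + oppositeTerm c (v 0) (v 2) (v 1) (v 3) +
      oppositeTerm c (v 0) (v 3) (v 1) (v 2)) +
      (pawTerm c (v 0) (v 1) (v 2) (v 3) + pawTerm c (v 0) (v 1) (v 3) (v 2) +
      pawTerm c (v 0) (v 2) (v 3) (v 1) + pawTerm c (v 1) (v 0) (v 2) (v 3) +
      pawTerm c (v 1) (v 0) (v 3) (v 2) + pawTerm c (v 1) (v 2) (v 3) (v 0) +
      pawTerm c (v 2) (v 0) (v 1) (v 3) + pawTerm c (v 2) (v 0) (v 3) (v 1) +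
      pawTerm c (v 2) (v 1) (v 3) (v 0) + pawTerm c (v 3) (v 0) (v 1) (v 2) +
      pawTerm c (v 3) (v 0) (v 2) (v 1) + pawTerm c (v 3) (v 1) (v 2) (v 0)) +
      (cycleTerm c (v 0) (v 1) (v 2) (v 3) + cycleTerm c (v 0) (v 2) (v 1) (v 3) +
      cycleTerm c (v 0) (v 3) (v 1) (v 2)) +
      completeTerm c (v 0) (v 1) (v 2) (v 3)) := by
  have h : ∀ i j, c (v i - v j) = c (v j - v i) := fun i j => signFun_sub_comm hneg _ _
  simp only [completeTerm, adjacentTerm, oppositeTerm, pawTerm, cycleTerm, h 1 0,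
    h 2 0, h 3 0, h 2 1, h 3 1, h 3 2]
  ring

theorem distinctSum_eq {i j k l : Fin 4} (h : Function.Injective ![i, j, k, l])
    (f : F → F → F → F → ℂ) :
    ∑ v : Fin 4 → F, distinctInd (v 0) (v 1) (v 2) (v 3) * f (v i) (v j) (v k) (v l) =
      distinctSum f :=
  sum_distinct_perm h f

omit [DecidableEq F] in
theorem sum_mul_left (f : F → F → F → F → ℂ) {t : F} (ht : t ≠ 0) :
    ∑ v : Fin 4 → F, f (t * v 0) (t * v 1) (t * v 2) (t * v 3) =
      ∑ v : Fin 4 → F, f (v 0) (v 1) (v 2) (v 3) :=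
  Fintype.sum_equiv (Equiv.piCongrRight fun _ => Equiv.mulLeft₀ t ht) _ _ fun _ => rfl

theorem distinctSum_mul_left (f : F → F → F → F → ℂ) {t : F} (ht : t ≠ 0) :
    distinctSum (fun a b x y => f (t * a) (t * b) (t * x) (t * y)) = distinctSum f := by
  have h : ∀ x : F, nonzeroInd (t * x) = nonzeroInd x := fun x => by simp [nonzeroInd, ht]
  have hd : ∀ a b x y : F, distinctInd (t * a) (t * b) (t * x) (t * y) = distinctInd a b x y := by
    intro a b x y
    simp only [distinctInd, ← mul_sub, h]
  have := sum_mul_left (fun a b x y => distinctInd a b x y * f a b x y) ht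
  simp only [hd] at this
  exact (sum_fin_four_eq _).symm.trans
    (this.trans (sum_fin_four_eq fun a b x y => distinctInd a b x y * f a b x y))

include hneg hsq hsum in
-- Scaling by t exchanges 1 + c and 1 - c, so the even part is the whole sum. With n the
-- cardinality, (n - 2)(n - 3) + 12(3 - n) + 3·2 + 12·2 + 3(β² + 3 - n) = n² - 20n + 81 + 3β².
theorem distinctSum_completeTerm_one_add {t : F} (ht : t ≠ 0) (hflip : ∀ x, c (t * x) = -c x)
    {ψ : F → ℂ} {β : ℂ} (hψsq : ∀ x, ψ x * ψ x = nonzeroInd x) (hψsum : ∑ x, ψ x = 0)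
    (hconv : ∀ a b, a ≠ b → ∑ x, c (a - x) * c (x - b) = β * ψ (a - b) - 1) :
    distinctSum (completeTerm fun x => 1 + c x) =
      Fintype.card F * (Fintype.card F - 1) *
        ((Fintype.card F : ℂ) ^ 2 - 20 * Fintype.card F + 81 + 3 * β ^ 2) +
      distinctSum (completeTerm c) := by
  have h1 : distinctSum (completeTerm fun x => 1 - c x) =
      distinctSum (completeTerm fun x => 1 + c x) := by
    rw [← distinctSum_mul_left _ ht]
    simp only [completeTerm, ← mul_sub, hflip, sub_neg_eq_add]
    rfl
  have h2 : distinctSum (completeTerm fun x => 1 + c x) +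
      distinctSum (completeTerm fun x => 1 - c x) = ∑ v : Fin 4 → F,
        distinctInd (v 0) (v 1) (v 2) (v 3) *
          (completeTerm (fun x => 1 + c x) (v 0) (v 1) (v 2) (v 3) +
        completeTerm (fun x => 1 - c x) (v 0) (v 1) (v 2) (v 3)) := by
    simp only [mul_add, Finset.sum_add_distrib]
    rw [distinctSum_eq (by decide), distinctSum_eq (by decide)]
  have hone : ∑ v : Fin 4 → F, distinctInd (v 0) (v 1) (v 2) (v 3) * 1 = _ :=
    (distinctSum_eq (i := 0) (j := 1) (k := 2) (l := 3) (by decide)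
      (fun _ _ _ _ : F => 1)).trans distinctSum_one
  have e1 : distinctSum (adjacentTerm c) = _ := distinctSum_adjacent hneg hsq hsum
  have e2 : distinctSum (oppositeTerm c) = _ := distinctSum_opposite hneg hsq hsum
  have e3 : distinctSum (pawTerm c) = _ := distinctSum_paw hneg hsq hsum
  have e4 : distinctSum (cycleTerm c) = _ := distinctSum_cycle hneg hsq hψsq hψsum hconv
  simp only [h1, completeTerm_one_add_add_one_sub hneg, mul_left_comm _ (2 : ℂ),
    ← Finset.mul_sum] at h2
  simp only [mul_add, Finset.sum_add_distrib, hone] at h2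
  simp (disch := decide) only [distinctSum_eq, e1, e2, e3, e4] at h2
  linear_combination h2 / 2

end SignFunction

/-! ### The K₄ term of the quartic sign function. -/

section Quartic

variable {F : Type*} [Field F] [Fintype F]

/-- Affine maps act simply transitively on ordered pairs of distinct points, so (a, b) may be
normalised to (0, 1). -/
theorem sum_homogeneous (f : F → F → F → F → ℂ)
    (htrans : ∀ t a b x y, f (a + t) (b + t) (x + t) (y + t) = f a b x y)
    (hscale : ∀ t, t ≠ 0 → ∀ a b x y, f (t * a) (t * b) (t * x) (t * y) = f a b x y)
    (h0 : ∀ x y, f 0 0 x y = 0) :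
    ∑ a, ∑ b, ∑ x, ∑ y, f a b x y =
      Fintype.card F * (Fintype.card F - 1) * ∑ x, ∑ y, f 0 1 x y := by
  classical
  have h1 : ∀ a, ∑ b, ∑ x, ∑ y, f a b x y = ∑ b, ∑ x, ∑ y, f 0 b x y := by
    intro a
    refine (Fintype.sum_equiv (Equiv.addRight a) _ _ fun b => ?_).symm
    refine Fintype.sum_equiv (Equiv.addRight a) _ _ fun x => ?_
    refine Fintype.sum_equiv (Equiv.addRight a) _ _ fun y => ?_
    simpa using (htrans a 0 b x y).symm
  have h2 : ∀ b, ∑ x, ∑ y, f 0 b x y = nonzeroInd (0 - b) * ∑ x, ∑ y, f 0 1 x y := by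
    intro b
    by_cases hb : b = 0
    · simp [hb, h0, nonzeroInd]
    have : nonzeroInd (0 - b) = 1 := by simp [nonzeroInd, hb]
    rw [this, one_mul]
    refine (Fintype.sum_equiv (Equiv.mulLeft₀ b hb) _ _ fun x => ?_).symm
    refine Fintype.sum_equiv (Equiv.mulLeft₀ b hb) _ _ fun y => ?_
    simpa using (hscale b hb 0 1 x y).symm
  rw [Finset.sum_congr rfl fun a _ => h1 a, Finset.sum_const,
    Finset.sum_congr rfl fun b _ => h2 b, ← Finset.sum_mul, sum_const_sub_left nonzeroInd,
    sum_nonzeroInd, Finset.card_univ, nsmul_eq_mul, mul_assoc]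

/-- The double character sum attached to a triangle and the complementary star. -/
noncomputable def triangleSum (χ : MulChar F ℂ) : ℂ :=
  ∑ u, ∑ v, χ u * χ v * χ⁻¹ (1 - u) * χ⁻¹ (1 - v) * χ (u - v)

/-- The double character sum attached to a path and the complementary path. -/
noncomputable def pathSum (χ : MulChar F ℂ) : ℂ :=
  ∑ u, ∑ v, χ u * χ⁻¹ v * χ⁻¹ (1 - u) * χ⁻¹ (1 - v) * χ (u - v)

/-- The product of `χ` over the triangle `axy` and of `χ⁻¹` over the star with centre `b`. -/
noncomputable def triangleTerm (χ : MulChar F ℂ) (a b x y : F) : ℂ :=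
  χ (a - x) * χ (a - y) * χ⁻¹ (x - b) * χ⁻¹ (y - b) * χ (x - y) * χ⁻¹ (a - b)

/-- The product of `χ` over the path `baxy` and of `χ⁻¹` over the remaining edges. -/
noncomputable def pathTerm (χ : MulChar F ℂ) (a b x y : F) : ℂ :=
  χ (a - x) * χ⁻¹ (a - y) * χ⁻¹ (b - x) * χ⁻¹ (b - y) * χ (x - y) * χ (a - b)

/-- The product of `χ` over the edge `xy` and of `χ⁻¹` over the remaining edges. -/
noncomputable def edgeTerm (χ : MulChar F ℂ) (a b x y : F) : ℂ :=
  χ⁻¹ (a - x) * χ⁻¹ (a - y) * χ⁻¹ (b - x) * χ⁻¹ (b - y) * χ (x - y) * χ⁻¹ (a - b)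

variable {χ : MulChar F ℂ}

omit [Fintype F] in
theorem mulChar_neg (hm : χ (-1) = 1) (x : F) : χ (-x) = χ x := by
  rw [← neg_one_mul, map_mul, hm, one_mul]

omit [Fintype F] in
theorem mulChar_inv_neg (hm : χ (-1) = 1) (x : F) : χ⁻¹ (-x) = χ⁻¹ x := by
  rw [MulChar.inv_apply_eq_inv', MulChar.inv_apply_eq_inv', mulChar_neg hm]

omit [Fintype F] in
theorem mulChar_mul_inv_apply {x : F} (hx : x ≠ 0) : χ x * χ⁻¹ x = 1 := by
  rw [MulChar.inv_apply_eq_inv', mul_inv_cancel₀]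
  exact ((isUnit_iff_ne_zero.2 hx).map χ).ne_zero

omit [Fintype F] in
theorem mulChar_pow_four_apply (h4 : χ ^ 4 = 1) {x : F} (hx : x ≠ 0) : χ x ^ 4 = 1 := by
  rw [← MulChar.pow_apply' _ (by norm_num), h4, MulChar.one_apply (isUnit_iff_ne_zero.2 hx)]

theorem sum_triangleTerm (hm : χ (-1) = 1) :
    ∑ a, ∑ b, ∑ x, ∑ y, triangleTerm χ a b x y =
      Fintype.card F * (Fintype.card F - 1) * triangleSum χ := by
  rw [sum_homogeneous]
  · congr 1
    refine Finset.sum_congr rfl fun x _ => Finset.sum_congr rfl fun y _ => ?_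
    rw [triangleTerm, ← neg_sub 1 x, ← neg_sub 1 y]
    simp only [zero_sub, mulChar_neg hm, mulChar_inv_neg hm, map_one, mul_one]
  · intros; simp only [triangleTerm, add_sub_add_right_eq_sub]
  · intro t ht a b x y
    simp only [triangleTerm, ← mul_sub, map_mul]
    have h := mulChar_mul_inv_apply (χ := χ) ht
    generalize χ t = z at *
    generalize χ⁻¹ t = w at *
    have h3 : (z * w) ^ 3 = 1 := by rw [h, one_pow]
    linear_combination (χ (a - x) * χ (a - y) * χ⁻¹ (x - b) * χ⁻¹ (y - b) * χ (x - y) *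
      χ⁻¹ (a - b)) * h3
  · intro x y; simp [triangleTerm, MulChar.map_zero]

theorem sum_pathTerm (hm : χ (-1) = 1) :
    ∑ a, ∑ b, ∑ x, ∑ y, pathTerm χ a b x y =
      Fintype.card F * (Fintype.card F - 1) * pathSum χ := by
  rw [sum_homogeneous]
  · congr 1
    refine Finset.sum_congr rfl fun x _ => Finset.sum_congr rfl fun y _ => ?_
    rw [pathTerm]
    simp only [zero_sub, mulChar_neg hm, mulChar_inv_neg hm, map_one, mul_one]
  · intros; simp only [pathTerm, add_sub_add_right_eq_sub]
  · intro t ht a b x y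
    simp only [pathTerm, ← mul_sub, map_mul]
    have h := mulChar_mul_inv_apply (χ := χ) ht
    generalize χ t = z at *
    generalize χ⁻¹ t = w at *
    have h3 : (z * w) ^ 3 = 1 := by rw [h, one_pow]
    linear_combination (χ (a - x) * χ⁻¹ (a - y) * χ⁻¹ (b - x) * χ⁻¹ (b - y) * χ (x - y) *
      χ (a - b)) * h3
  · intro x y; simp [pathTerm, MulChar.map_zero]

/-- After normalising to a = 0, b = 1, inverting x and y turns the sum into the triangle sum. One χ
against five χ⁻¹ scales by χ(t)⁻⁴, so homogeneity needs χ⁴ = 1. -/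
theorem sum_edgeTerm (hm : χ (-1) = 1) (h4 : χ ^ 4 = 1) :
    ∑ a, ∑ b, ∑ x, ∑ y, edgeTerm χ a b x y =
      Fintype.card F * (Fintype.card F - 1) * triangleSum χ := by
  rw [sum_homogeneous]
  · congr 1
    refine Fintype.sum_equiv (Equiv.inv F) _ _ fun x => ?_
    refine Fintype.sum_equiv (Equiv.inv F) _ _ fun y => ?_
    simp only [Equiv.inv_apply]
    by_cases hx : x = 0
    · simp [hx, edgeTerm, MulChar.map_zero]
    by_cases hy : y = 0
    · simp [hy, edgeTerm, MulChar.map_zero]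
    have e1 : 1 - x⁻¹ = -((1 - x) * x⁻¹) := by field_simp; ring
    have e2 : 1 - y⁻¹ = -((1 - y) * y⁻¹) := by field_simp; ring
    have e3 : x⁻¹ - y⁻¹ = -((x - y) * x⁻¹ * y⁻¹) := by field_simp; ring
    have i1 : ∀ z : F, χ z⁻¹ = χ⁻¹ z := fun z => (MulChar.inv_apply' χ z).symm
    have i2 : ∀ z : F, χ⁻¹ z⁻¹ = χ z := fun z => by rw [MulChar.inv_apply', inv_inv]
    rw [edgeTerm, e1, e2, e3]
    simp only [zero_sub, mulChar_neg hm, mulChar_inv_neg hm, map_mul, map_one, mul_one, i1, i2]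
    have hx' := mulChar_mul_inv_apply (χ := χ) hx
    have hy' := mulChar_mul_inv_apply (χ := χ) hy
    linear_combination (-(χ⁻¹ x) * χ⁻¹ y * χ⁻¹ (1 - x) * χ⁻¹ (1 - y) * χ (x - y)) *
      (hx' + χ x * χ⁻¹ x * hy')
  · intros; simp only [edgeTerm, add_sub_add_right_eq_sub]
  · intro t ht a b x y
    simp only [edgeTerm, ← mul_sub, map_mul]
    have h := mulChar_mul_inv_apply (χ := χ) ht
    have h' := mulChar_pow_four_apply h4 ht
    generalize χ t = z at *
    generalize χ⁻¹ t = w at *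
    have hw : w ^ 4 = 1 := by
      have : (z * w) ^ 4 = 1 := by rw [h, one_pow]
      rwa [mul_pow, h', one_mul] at this
    linear_combination (χ⁻¹ (a - x) * χ⁻¹ (a - y) * χ⁻¹ (b - x) * χ⁻¹ (b - y) * χ (x - y) *
      χ⁻¹ (a - b)) * (w ^ 4 * h + hw)
  · intro x y; simp [edgeTerm, MulChar.map_zero]

/-- The sign function `((1 - ω) χ + (1 + ω) χ⁻¹) / 2` attached to a quartic character `χ` and a
square root `ω` of `-1`. It is `1` where `χ` is `1` or `ω` and `-1` where `χ` is `-1` or `-ω`. -/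
noncomputable def quarticSign (χ : MulChar F ℂ) (ω : ℂ) (x : F) : ℂ :=
  ((1 - ω) * χ x + (1 + ω) * χ⁻¹ x) / 2

/-- As (1 ∓ ω)² = ∓2ω and (1 - ω)(1 + ω) = 2, a monomial with k factors xᵢ has total weight 16 for k
= 3, -16 for k = 1 or 5, and 0 for even k. Multiplying in pairs keeps the computation small. -/
theorem prod_six_add_swap {ω : ℂ} (hω : ω ^ 2 = -1)
    (x₁ x₂ x₃ x₄ x₅ x₆ y₁ y₂ y₃ y₄ y₅ y₆ : ℂ) :
    ((1 - ω) * x₁ + (1 + ω) * y₁) * ((1 - ω) * x₂ + (1 + ω) * y₂) *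
      ((1 - ω) * x₃ + (1 + ω) * y₃) * ((1 - ω) * x₄ + (1 + ω) * y₄) *
      ((1 - ω) * x₅ + (1 + ω) * y₅) * ((1 - ω) * x₆ + (1 + ω) * y₆) +
    ((1 + ω) * x₁ + (1 - ω) * y₁) * ((1 + ω) * x₂ + (1 - ω) * y₂) *
      ((1 + ω) * x₃ + (1 - ω) * y₃) * ((1 + ω) * x₄ + (1 - ω) * y₄) *
      ((1 + ω) * x₅ + (1 - ω) * y₅) * ((1 + ω) * x₆ + (1 - ω) * y₆) =
    16 * ((x₁ * y₂ + y₁ * x₂) * (x₃ * y₄ + y₃ * x₄) * (x₅ * y₆ + y₅ * x₆) -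
      ((x₁ * y₂ + y₁ * x₂) * (y₃ * y₄ - x₃ * x₄) * (y₅ * y₆ - x₅ * x₆) +
       (y₁ * y₂ - x₁ * x₂) * (x₃ * y₄ + y₃ * x₄) * (y₅ * y₆ - x₅ * x₆) +
       (y₁ * y₂ - x₁ * x₂) * (y₃ * y₄ - x₃ * x₄) * (x₅ * y₆ + y₅ * x₆))) := by
  have h1 : ∀ x y x' y' : ℂ, ((1 - ω) * x + (1 + ω) * y) * ((1 - ω) * x' + (1 + ω) * y') =
      2 * ((x * y' + y * x') + ω * (y * y' - x * x')) := fun x y x' y' => by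
    linear_combination (x * x' + y * y' - x * y' - y * x') * hω
  have h2 : ∀ x y x' y' : ℂ, ((1 + ω) * x + (1 - ω) * y) * ((1 + ω) * x' + (1 - ω) * y') =
      2 * ((x * y' + y * x') - ω * (y * y' - x * x')) := fun x y x' y' => by
    linear_combination (x * x' + y * y' - x * y' - y * x') * hω
  have h3 : ∀ z₁ z₂ z₃ z₄ z₅ z₆ : ℂ, z₁ * z₂ * z₃ * z₄ * z₅ * z₆ =
      (z₁ * z₂) * (z₃ * z₄) * (z₅ * z₆) := fun _ _ _ _ _ _ => by ring
  rw [h3, h3 ((1 + ω) * x₁ + (1 - ω) * y₁)]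
  simp only [h1, h2]
  generalize x₁ * y₂ + y₁ * x₂ = B₁
  generalize x₃ * y₄ + y₃ * x₄ = B₂
  generalize x₅ * y₆ + y₅ * x₆ = B₃
  generalize y₁ * y₂ - x₁ * x₂ = U₁
  generalize y₃ * y₄ - x₃ * x₄ = U₂
  generalize y₅ * y₆ - x₅ * x₆ = U₃
  linear_combination 16 * (B₁ * U₂ * U₃ + U₁ * B₂ * U₃ + U₁ * U₂ * B₃) * hω

omit [Fintype F] in
-- The 20 choices of three edges for χ are 4 triangles, 4 stars (triangles for χ⁻¹) and 12 paths;
-- one or five edges give 6 + 6 edge terms with the opposite sign.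
theorem completeTerm_quarticSign_add (hm : χ (-1) = 1) {ω : ℂ} (hω : ω ^ 2 = -1)
    (v : Fin 4 → F) :
    completeTerm (quarticSign χ ω) (v 0) (v 1) (v 2) (v 3) +
        completeTerm (quarticSign χ (-ω)) (v 0) (v 1) (v 2) (v 3) = 1 / 4 *
      (triangleTerm χ (v 1) (v 0) (v 2) (v 3) + triangleTerm χ (v 0) (v 1) (v 2) (v 3) +
      triangleTerm χ (v 0) (v 2) (v 1) (v 3) + triangleTerm χ (v 0) (v 3) (v 1) (v 2) +
      triangleTerm χ⁻¹ (v 1) (v 0) (v 2) (v 3) + triangleTerm χ⁻¹ (v 0) (v 1) (v 2) (v 3) +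
      triangleTerm χ⁻¹ (v 0) (v 2) (v 1) (v 3) + triangleTerm χ⁻¹ (v 0) (v 3) (v 1) (v 2) +
      (pathTerm χ (v 0) (v 1) (v 2) (v 3) + pathTerm χ (v 0) (v 1) (v 3) (v 2) +
      pathTerm χ (v 0) (v 2) (v 1) (v 3) + pathTerm χ (v 1) (v 0) (v 2) (v 3) +
      pathTerm χ (v 1) (v 0) (v 3) (v 2) + pathTerm χ (v 1) (v 2) (v 0) (v 3) +
      pathTerm χ (v 2) (v 0) (v 1) (v 3) + pathTerm χ (v 2) (v 0) (v 3) (v 1) +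
      pathTerm χ (v 2) (v 1) (v 0) (v 3) + pathTerm χ (v 3) (v 0) (v 1) (v 2) +
      pathTerm χ (v 3) (v 0) (v 2) (v 1) + pathTerm χ (v 3) (v 1) (v 0) (v 2)) -
      (edgeTerm χ (v 0) (v 1) (v 2) (v 3) + edgeTerm χ (v 0) (v 2) (v 1) (v 3) +
      edgeTerm χ (v 0) (v 3) (v 1) (v 2) + edgeTerm χ (v 1) (v 2) (v 0) (v 3) +
      edgeTerm χ (v 1) (v 3) (v 0) (v 2) + edgeTerm χ (v 2) (v 3) (v 0) (v 1)) -
      (edgeTerm χ⁻¹ (v 0) (v 1) (v 2) (v 3) + edgeTerm χ⁻¹ (v 0) (v 2) (v 1) (v 3) +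
      edgeTerm χ⁻¹ (v 0) (v 3) (v 1) (v 2) + edgeTerm χ⁻¹ (v 1) (v 2) (v 0) (v 3) +
      edgeTerm χ⁻¹ (v 1) (v 3) (v 0) (v 2) + edgeTerm χ⁻¹ (v 2) (v 3) (v 0) (v 1))) := by
  have h : ∀ i j, χ (v i - v j) = χ (v j - v i) := fun i j => by rw [← mulChar_neg hm, neg_sub]
  have h' : ∀ i j, χ⁻¹ (v i - v j) = χ⁻¹ (v j - v i) := fun i j => by
    rw [← mulChar_inv_neg hm, neg_sub]
  have key := prod_six_add_swap hω (χ (v 0 - v 1)) (χ (v 0 - v 2)) (χ (v 0 - v 3))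
    (χ (v 1 - v 2)) (χ (v 1 - v 3)) (χ (v 2 - v 3)) (χ⁻¹ (v 0 - v 1)) (χ⁻¹ (v 0 - v 2))
    (χ⁻¹ (v 0 - v 3)) (χ⁻¹ (v 1 - v 2)) (χ⁻¹ (v 1 - v 3)) (χ⁻¹ (v 2 - v 3))
  simp only [completeTerm, quarticSign, triangleTerm, pathTerm, edgeTerm, inv_inv,
    h 1 0, h 2 0, h 3 0, h 2 1, h 3 1, h 3 2,
    h' 1 0, h' 2 0, h' 3 0, h' 2 1, h' 3 1, h' 3 2]
  linear_combination key / 64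

/-- Scaling by t replaces ω by -ω, so the sum is half the symmetrised one. Edge terms sum to
triangle sums, leaving coefficient 4 - 6 = -2 for each triangle sum and 12 for the path sum, before
the factor 1/4. -/
theorem sum_completeTerm_quarticSign (hm : χ (-1) = 1) (h4 : χ ^ 4 = 1) {ω : ℂ}
    (hω : ω ^ 2 = -1) {t : F} (ht : χ t = ω) :
    ∑ a, ∑ b, ∑ x, ∑ y, completeTerm (quarticSign χ ω) a b x y =
      Fintype.card F * (Fintype.card F - 1) *
        ((3 * pathSum χ - (triangleSum χ + triangleSum χ⁻¹) / 2) / 2) := by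
  have hm' : χ⁻¹ (-1) = 1 := by rw [mulChar_inv_neg hm, map_one]
  have h4' : χ⁻¹ ^ 4 = 1 := by rw [inv_pow, h4, inv_one]
  have ht0 : t ≠ 0 := by
    rintro rfl
    rw [MulChar.map_zero] at ht
    simp [← ht] at hω
  have hti : χ⁻¹ t = -ω := by
    rw [MulChar.inv_apply_eq_inv', ht]
    refine inv_eq_of_mul_eq_one_right ?_
    linear_combination -hω
  have hs : ∀ x, quarticSign χ ω (t * x) = quarticSign χ (-ω) x := by
    intro x
    simp only [quarticSign, map_mul, ht, hti]
    linear_combination (-(χ x + χ⁻¹ x) / 2) * hω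
  have h1 : ∑ v : Fin 4 → F, completeTerm (quarticSign χ (-ω)) (v 0) (v 1) (v 2) (v 3) =
      ∑ v : Fin 4 → F, completeTerm (quarticSign χ ω) (v 0) (v 1) (v 2) (v 3) := by
    rw [← sum_mul_left (completeTerm (quarticSign χ ω)) ht0]
    simp only [completeTerm, ← mul_sub, hs]
  have h2 := Finset.sum_congr rfl fun (v : Fin 4 → F) (_ : v ∈ Finset.univ) =>
    completeTerm_quarticSign_add hm hω v
  rw [Finset.sum_add_distrib, h1, sum_fin_four_eq] at h2
  have e1 := sum_triangleTerm hm
  have e2 := sum_triangleTerm hm'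
  have e3 := sum_pathTerm hm
  have e4 := sum_edgeTerm hm h4
  have e5 := sum_edgeTerm hm' h4'
  rw [← Finset.mul_sum] at h2
  simp only [Finset.sum_add_distrib, Finset.sum_sub_distrib] at h2
  simp (disch := decide) only [sum_fin_four_perm, e1, e2, e3, e4, e5] at h2
  linear_combination h2 / 2

end Quartic

/-! ### The ordered clique count over a finite field. -/

section FieldCount

variable {F : Type*} [Field F] [Fintype F]

theorem sum_convolution_mulChar (A B : MulChar F ℂ) {a b : F} (hab : a ≠ b) :
    ∑ x, A (a - x) * B (x - b) = (A * B) (a - b) * jacobiSum A B := by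
  have hd : a - b ≠ 0 := sub_ne_zero.2 hab
  rw [jacobiSum_comm, jacobiSum, Finset.mul_sum]
  refine (Fintype.sum_equiv ((Equiv.mulLeft₀ (a - b) hd).trans (Equiv.addRight b)) _ _
    fun t => ?_).symm
  have h1 : a - ((a - b) * t + b) = (a - b) * (1 - t) := by ring
  have h2 : (a - b) * t + b - b = (a - b) * t := by ring
  change _ = A (a - ((a - b) * t + b)) * B ((a - b) * t + b - b)
  rw [h1, h2, map_mul, map_mul, MulChar.mul_apply]
  ring

variable {χ : MulChar F ℂ}

omit [Fintype F] in
theorem inv_apply_sq (h4 : χ ^ 4 = 1) (x : F) : χ⁻¹ x * χ⁻¹ x = χ x * χ x := by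
  have h : χ⁻¹ * χ⁻¹ = χ * χ := by
    rw [← mul_inv, inv_eq_iff_mul_eq_one, ← h4, ← sq, ← sq, ← pow_mul]
  simpa only [MulChar.mul_apply] using congrArg (fun ψ => ψ x) h

omit [Fintype F] in
theorem quarticSign_neg (hm : χ (-1) = 1) (ω : ℂ) (x : F) :
    quarticSign χ ω (-x) = quarticSign χ ω x := by
  rw [quarticSign, mulChar_neg hm, mulChar_inv_neg hm, quarticSign]

omit [Fintype F] in
theorem quarticSign_mul_self [DecidableEq F] (h4 : χ ^ 4 = 1) {ω : ℂ} (hω : ω ^ 2 = -1) (x : F) :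
    quarticSign χ ω x * quarticSign χ ω x = nonzeroInd x := by
  by_cases hx : x = 0
  · simp [hx, quarticSign, nonzeroInd, MulChar.map_zero]
  have h1 := inv_apply_sq h4 x
  have h2 := mulChar_mul_inv_apply (χ := χ) hx
  have h3 : nonzeroInd x = 1 := by simp [nonzeroInd, hx]
  rw [h3, quarticSign]
  linear_combination (1 + ω) ^ 2 / 4 * h1 + (1 - ω ^ 2) / 2 * h2 +
    (χ x ^ 2 - 1) / 2 * hω

theorem sum_quarticSign (h : χ ≠ 1) (ω : ℂ) : ∑ x, quarticSign χ ω x = 0 := by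
  simp only [quarticSign, ← Finset.sum_div, Finset.sum_add_distrib, ← Finset.mul_sum,
    MulChar.sum_eq_zero_of_ne_one h, MulChar.sum_eq_zero_of_ne_one (inv_ne_one.2 h)]
  simp

/-- The mixed terms give J(χ,χ⁻¹) = -χ(-1) = -1. The pure terms carry (1 ∓ ω)²/4 = ∓ω/2, and both
involve χ² because χ⁻² = χ². -/
theorem quarticSign_convolution (hm : χ (-1) = 1) (h4 : χ ^ 4 = 1) (h1 : χ ≠ 1) {ω : ℂ}
    (hω : ω ^ 2 = -1) {a b : F} (hab : a ≠ b) :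
    ∑ x, quarticSign χ ω (a - x) * quarticSign χ ω (x - b) =
      (-ω * (jacobiSum χ χ - jacobiSum χ⁻¹ χ⁻¹) / 2) * (χ (a - b) * χ (a - b)) - 1 := by
  classical
  have e1 := sum_convolution_mulChar χ χ hab
  have e2 := sum_convolution_mulChar χ χ⁻¹ hab
  have e3 := sum_convolution_mulChar χ⁻¹ χ hab
  have e4 := sum_convolution_mulChar χ⁻¹ χ⁻¹ hab
  have hu : IsUnit (a - b) := isUnit_iff_ne_zero.2 (sub_ne_zero.2 hab)
  rw [jacobiSum_comm χ⁻¹ χ, inv_mul_cancel, MulChar.one_apply hu,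
    jacobiSum_nontrivial_inv h1, hm] at e3
  rw [mul_inv_cancel, MulChar.one_apply hu, jacobiSum_nontrivial_inv h1, hm] at e2
  rw [MulChar.mul_apply] at e1
  rw [MulChar.mul_apply, inv_apply_sq h4] at e4
  have hx : ∀ x, quarticSign χ ω (a - x) * quarticSign χ ω (x - b) =
      (1 - ω) ^ 2 / 4 * (χ (a - x) * χ (x - b)) + (1 - ω ^ 2) / 4 * (χ (a - x) * χ⁻¹ (x - b)) +
      (1 - ω ^ 2) / 4 * (χ⁻¹ (a - x) * χ (x - b)) +
      (1 + ω) ^ 2 / 4 * (χ⁻¹ (a - x) * χ⁻¹ (x - b)) := fun x => by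
    rw [quarticSign, quarticSign]
    ring
  simp only [hx, Finset.sum_add_distrib, ← Finset.mul_sum, e1, e2, e3, e4]
  linear_combination (χ (a - b) * χ (a - b) * (jacobiSum χ χ + jacobiSum χ⁻¹ χ⁻¹) / 4 + 1 / 2) * hω

theorem sum_sq_mulChar (h2 : χ ^ 2 ≠ 1) : ∑ x, χ x * χ x = 0 := by
  rw [← MulChar.sum_eq_zero_of_ne_one h2]
  exact Finset.sum_congr rfl fun x _ => by rw [sq, MulChar.mul_apply]

theorem sum_completeTerm_indicator [DecidableEq F] (hm : χ (-1) = 1) (h4 : χ ^ 4 = 1)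
    (h2 : χ ^ 2 ≠ 1) {ω : ℂ} (hω : ω ^ 2 = -1) {t : F} (ht : χ t = ω) :
    ∑ a, ∑ b, ∑ x, ∑ y,
        completeTerm (fun z => (nonzeroInd z + quarticSign χ ω z) / 2) a b x y =
      Fintype.card F * (Fintype.card F - 1) / 64 *
        ((Fintype.card F : ℂ) ^ 2 - 20 * Fintype.card F + 81 -
          3 / 4 * (jacobiSum χ χ - jacobiSum χ⁻¹ χ⁻¹) ^ 2 +
          (3 * pathSum χ - (triangleSum χ + triangleSum χ⁻¹) / 2) / 2) := by
  have h1 : χ ≠ 1 := fun h => h2 (by rw [h, one_pow])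
  have hsq := quarticSign_mul_self h4 hω
  have ht0 : t ≠ 0 := by
    rintro rfl
    rw [MulChar.map_zero] at ht
    simp [← ht] at hω
  have hti : χ⁻¹ t = -ω := by
    rw [MulChar.inv_apply_eq_inv', ht]
    refine inv_eq_of_mul_eq_one_right ?_
    linear_combination -hω
  have hflip : ∀ x, quarticSign χ ω (t * t * x) = -quarticSign χ ω x := by
    intro x
    simp only [quarticSign, map_mul, ht, hti]
    linear_combination ((1 - ω) * χ x + (1 + ω) * χ⁻¹ x) / 2 * hω
  have hψ : ∀ x, χ x * χ x * (χ x * χ x) = nonzeroInd x := by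
    intro x
    by_cases hx : x = 0
    · simp [hx, nonzeroInd, MulChar.map_zero]
    · rw [show nonzeroInd x = 1 by simp [nonzeroInd, hx], ← mulChar_pow_four_apply h4 hx]
      ring
  have hmain := distinctSum_completeTerm_one_add (quarticSign_neg hm ω) hsq
    (sum_quarticSign h1 ω) (mul_ne_zero ht0 ht0) hflip hψ (sum_sq_mulChar h2)
    (fun a b hab => quarticSign_convolution hm h4 h1 hω hab)
  have he : ∀ z : F, quarticSign χ ω z = nonzeroInd z * quarticSign χ ω z := by
    intro z
    by_cases hz : z = 0
    · simp [hz, quarticSign, nonzeroInd, MulChar.map_zero]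
    · simp [nonzeroInd, hz]
  have hcomplete : distinctSum (completeTerm (quarticSign χ ω)) =
      ∑ a, ∑ b, ∑ x, ∑ y, completeTerm (quarticSign χ ω) a b x y := by
    refine Finset.sum_congr rfl fun a _ => Finset.sum_congr rfl fun b _ =>
      Finset.sum_congr rfl fun x _ => Finset.sum_congr rfl fun y _ => ?_
    simp only [completeTerm, distinctInd]
    conv_rhs => rw [he (a - b), he (a - x), he (a - y), he (b - x), he (b - y), he (x - y)]
    ring
  rw [hcomplete, sum_completeTerm_quarticSign hm h4 hω ht] at hmain
  have hind : ∀ a b x y : F,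
      completeTerm (fun z => (nonzeroInd z + quarticSign χ ω z) / 2) a b x y =
      1 / 64 * (distinctInd a b x y * completeTerm (fun z => 1 + quarticSign χ ω z) a b x y) := by
    intro a b x y
    have he' : ∀ z : F, nonzeroInd z + quarticSign χ ω z =
        nonzeroInd z * (1 + quarticSign χ ω z) := fun z => by rw [mul_add, mul_one, ← he]
    simp only [completeTerm, distinctInd, he']
    ring
  simp only [hind, ← Finset.mul_sum]
  change 1 / 64 * distinctSum (completeTerm fun z => 1 + quarticSign χ ω z) = _
  rw [hmain]
  linear_combination Fintype.card F * ((Fintype.card F : ℂ) - 1) / 64 * 3 / 4 *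
    (jacobiSum χ χ - jacobiSum χ⁻¹ χ⁻¹) ^ 2 * hω

end FieldCount

/-! ### A change of variable in Jacobi sums. -/

section JacobiSumTransformation

variable {R : Type*} [CommRing R] [Fintype R]

theorem sum_eq_sum_units [Fintype Rˣ] (f : R → ℂ) (hf : ∀ x, ¬IsUnit x → f x = 0) :
    ∑ x, f x = ∑ u : Rˣ, f u := by
  refine (Fintype.sum_of_injective Units.val Units.val_injective _ _ (fun x hx => ?_)
    fun _ => rfl).symm
  exact hf x fun ⟨u, hu⟩ => hx ⟨u, hu⟩

/-- The map x ↦ x/(x - 1) is an involution of the points where x and x - 1 are units; elsewhere both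
summands vanish. -/
theorem jacobiSum_eq_sum_sub_one (A B : MulChar R ℂ) :
    jacobiSum A B = B (-1) * ∑ u, A u * (A * B)⁻¹ (u - 1) := by
  classical
  have hunit : ∀ {x : R}, IsUnit (1 - x) ↔ IsUnit (x - 1) := fun {x} => by
    rw [← neg_sub, IsUnit.neg_iff]
  have hsub : ∀ {x : R}, IsUnit (x - 1) →
      x * Ring.inverse (x - 1) - 1 = Ring.inverse (x - 1) := fun {x} hx => by
    have h := Ring.mul_inverse_cancel _ hx
    linear_combination h
  have hinv : ∀ {x : R}, IsUnit (x - 1) →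
      x * Ring.inverse (x - 1) * Ring.inverse (x * Ring.inverse (x - 1) - 1) = x :=
    fun {x} hx => by
      rw [hsub hx, mul_assoc, Ring.mul_inverse_cancel _ (hx.ringInverse), mul_one]
  rw [jacobiSum, Finset.mul_sum]
  rw [← Finset.sum_filter_of_ne (p := fun x => IsUnit x ∧ IsUnit (x - 1)),
    ← Finset.sum_filter_of_ne (p := fun x => IsUnit x ∧ IsUnit (x - 1))
      (f := fun u => B (-1) * (A u * (A * B)⁻¹ (u - 1)))]
  · refine Finset.sum_nbij' (fun x => x * Ring.inverse (x - 1))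
      (fun x => x * Ring.inverse (x - 1)) ?_ ?_ ?_ ?_ ?_
    · simp only [Finset.mem_filter, Finset.mem_univ, true_and]
      rintro x ⟨h1, h2⟩
      rw [hsub h2]
      exact ⟨h1.mul h2.ringInverse, h2.ringInverse⟩
    · simp only [Finset.mem_filter, Finset.mem_univ, true_and]
      rintro x ⟨h1, h2⟩
      rw [hsub h2]
      exact ⟨h1.mul h2.ringInverse, h2.ringInverse⟩
    · simp only [Finset.mem_filter, Finset.mem_univ, true_and]
      exact fun x hx => hinv hx.2
    · simp only [Finset.mem_filter, Finset.mem_univ, true_and]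
      exact fun x hx => hinv hx.2
    · simp only [Finset.mem_filter, Finset.mem_univ, true_and]
      rintro x ⟨-, h2⟩
      have h3 : A (Ring.inverse (x - 1)) * A (x - 1) = 1 := by
        rw [← map_mul, Ring.inverse_mul_cancel _ h2, map_one]
      have h4 : (A * B)⁻¹ (Ring.inverse (x - 1)) = A (x - 1) * B (x - 1) := by
        rw [MulChar.inv_apply, Ring.inverse_inverse h2, MulChar.mul_apply]
      rw [hsub h2, h4, map_mul, ← neg_sub x 1, ← neg_one_mul (x - 1), map_mul]
      linear_combination (-A x * B (-1) * B (x - 1)) * h3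
  · intro x _ hx
    by_contra h
    rw [not_and_or] at h
    rcases h with h | h
    · exact hx (by rw [MulChar.map_nonunit _ h]; ring)
    · exact hx (by rw [MulChar.map_nonunit (A * B)⁻¹ h]; ring)
  · intro x _ hx
    by_contra h
    rw [not_and_or, ← hunit] at h
    rcases h with h | h
    · exact hx (by rw [MulChar.map_nonunit _ h]; ring)
    · exact hx (by rw [MulChar.map_nonunit B h]; ring)

end JacobiSumTransformation

/-! ### The hypergeometric values as double character sums. -/

section Hypergeometric

variable {q : ℕ} [NeZero q]

theorem dirichletBinom_eq_sum (A B : DirichletCharacter ℂ q) :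
    dirichletBinom A B = (q : ℂ)⁻¹ * ∑ u, A u * (A⁻¹ * B) (u - 1) := by
  have h : B (-1) * B⁻¹ (-1) = 1 := by
    rw [← MulChar.mul_apply, mul_inv_cancel, MulChar.one_apply isUnit_one.neg]
  rw [dirichletBinom, jacobiSum_eq_sum_sub_one, mul_inv, inv_inv]
  linear_combination ((q : ℂ)⁻¹ * ∑ u, A u * (A⁻¹ * B) (u - 1)) * h

/-- In this form χ cancels from the factor at u - 1 and survives only as χ(u), which makes the sum
over χ accessible to orthogonality. -/
theorem dirichletBinom_mul_eq_sum (A B χ : DirichletCharacter ℂ q) :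
    dirichletBinom (A * χ) (B * χ) =
      (q : ℂ)⁻¹ * ∑ u, A u * (A⁻¹ * B) (u - 1) * χ u := by
  have h : (A * χ)⁻¹ * (B * χ) = A⁻¹ * B := by
    rw [mul_inv, mul_mul_mul_comm, inv_mul_cancel, mul_one]
  rw [dirichletBinom_eq_sum, h]
  congr 1
  exact Finset.sum_congr rfl fun u _ => by rw [MulChar.mul_apply]; ring

/-- Orthogonality forces uvw = 1, parametrised by u = a, v = b⁻¹, w = ba⁻¹. -/
theorem sum_triple_characters (f g h : ZMod q → ℂ) :
    ∑ χ : DirichletCharacter ℂ q, (∑ u, f u * χ u) * (∑ v, g v * χ v) * (∑ w, h w * χ w) =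
      q.totient * ∑ a : (ZMod q)ˣ, ∑ b : (ZMod q)ˣ,
        f a * g (b⁻¹ : (ZMod q)ˣ) * h (b * a⁻¹ : (ZMod q)ˣ) := by
  have hu : ∀ (χ : DirichletCharacter ℂ q) (f : ZMod q → ℂ),
      ∑ u, f u * χ u = ∑ u : (ZMod q)ˣ, f u * χ u := fun χ f =>
    sum_eq_sum_units _ fun x hx => by rw [MulChar.map_nonunit _ hx, mul_zero]
  have hexp : ∀ χ : DirichletCharacter ℂ q,
      (∑ u, f u * χ u) * (∑ v, g v * χ v) * (∑ w, h w * χ w) =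
      ∑ a : (ZMod q)ˣ, ∑ b : (ZMod q)ˣ, ∑ c : (ZMod q)ˣ,
        f a * g (b⁻¹ : (ZMod q)ˣ) * h c * χ ((a * b⁻¹ * c : (ZMod q)ˣ) : ZMod q) := by
    intro χ
    rw [hu, hu, hu, ← Equiv.sum_comp (Equiv.inv (ZMod q)ˣ) (fun v => g v * χ v)]
    simp only [Finset.sum_mul, Finset.mul_sum, Equiv.inv_apply, Units.val_mul, map_mul]
    refine Eq.trans ?_ (Finset.sum_congr rfl fun a _ => Finset.sum_comm)
    rw [Finset.sum_comm]
    refine Eq.trans (Finset.sum_congr rfl fun a _ => Finset.sum_comm) ?_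
    rw [Finset.sum_comm]
    refine Eq.trans (Finset.sum_congr rfl fun a _ => Finset.sum_comm) ?_
    refine Finset.sum_congr rfl fun a _ => Finset.sum_congr rfl fun b _ =>
      Finset.sum_congr rfl fun c _ => by ring
  simp only [hexp]
  rw [Finset.sum_comm, Finset.mul_sum]
  refine Finset.sum_congr rfl fun a _ => ?_
  rw [Finset.sum_comm, Finset.mul_sum]
  refine Finset.sum_congr rfl fun b _ => ?_
  rw [Finset.sum_comm]
  have hc : ∀ c : (ZMod q)ˣ, (a * b⁻¹ * c = 1) ↔ b * a⁻¹ = c := by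
    intro c
    rw [mul_eq_one_iff_inv_eq, mul_inv, inv_inv, mul_comm]
  simp only [← Finset.mul_sum, DirichletCharacter.sum_characters_eq, Units.val_eq_one, hc,
    mul_ite, mul_zero, Finset.sum_ite_eq, Finset.mem_univ, if_true]
  ring

theorem dirichletHypergeometric_three_two (A₀ A₁ A₂ B₁ B₂ : DirichletCharacter ℂ q) :
    (q : ℂ) ^ 2 * dirichletHypergeometric A₀ ![A₁, A₂] ![B₁, B₂] 1 =
      ∑ a, ∑ b, (A₀ * B₂⁻¹) a * (A₂ * B₁⁻¹) b * A₀⁻¹ (a - 1) * (A₁⁻¹ * B₁) (1 - b) *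
        (A₂⁻¹ * B₂) (b - a) := by
  have hq : (q : ℂ) ≠ 0 := Nat.cast_ne_zero.2 (NeZero.ne q)
  have hφ : (q.totient : ℂ) ≠ 0 :=
    Nat.cast_ne_zero.2 (Nat.totient_pos.2 (Nat.pos_of_ne_zero (NeZero.ne q))).ne'
  have h0 : ∀ χ : DirichletCharacter ℂ q, dirichletBinom (A₀ * χ) χ =
      (q : ℂ)⁻¹ * ∑ u, A₀ u * A₀⁻¹ (u - 1) * χ u := fun χ => by
    simpa using dirichletBinom_mul_eq_sum A₀ 1 χ
  have hprod : ∀ χ : DirichletCharacter ℂ q,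
      dirichletBinom (A₀ * χ) χ *
        (∏ i : Fin 2, dirichletBinom (![A₁, A₂] i * χ) (![B₁, B₂] i * χ)) * χ 1 =
      ((q : ℂ)⁻¹) ^ 3 * ((∑ u, A₀ u * A₀⁻¹ (u - 1) * χ u) *
        (∑ v, A₁ v * (A₁⁻¹ * B₁) (v - 1) * χ v) *
        (∑ w, A₂ w * (A₂⁻¹ * B₂) (w - 1) * χ w)) := by
    intro χ
    rw [Fin.prod_univ_two, map_one]
    simp only [Matrix.cons_val_zero, Matrix.cons_val_one, h0, dirichletBinom_mul_eq_sum]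
    ring
  rw [dirichletHypergeometric, Finset.sum_congr rfl fun χ _ => hprod χ, ← Finset.mul_sum,
    sum_triple_characters (fun u => A₀ u * A₀⁻¹ (u - 1))
      (fun u => A₁ u * (A₁⁻¹ * B₁) (u - 1)) (fun u => A₂ u * (A₂⁻¹ * B₂) (u - 1))]
  -- The factor q² is exactly what cancels q/φ(q), the three factors 1/q of the binomials and the
  -- φ(q) from orthogonality.
  have hcancel : ∀ S : ℂ, (q : ℂ) ^ 2 * (q / q.totient * ((q : ℂ)⁻¹ ^ 3 * (q.totient * S))) = S :=
    fun S => by field_simp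
  rw [hcancel]
  symm
  rw [sum_eq_sum_units (R := ZMod q) _ fun a ha => ?_]
  · refine Finset.sum_congr rfl fun a _ => ?_
    rw [sum_eq_sum_units (R := ZMod q) _ fun b hb => ?_]
    · refine Finset.sum_congr rfl fun b _ => ?_
      have e1 : ((b⁻¹ : (ZMod q)ˣ) : ZMod q) - 1 = (1 - b) * (b⁻¹ : (ZMod q)ˣ) := by
        rw [sub_mul, Units.mul_inv, one_mul]
      have e2 : ((b * a⁻¹ : (ZMod q)ˣ) : ZMod q) - 1 = (b - a) * (a⁻¹ : (ZMod q)ˣ) := by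
        rw [sub_mul, Units.mul_inv, Units.val_mul]
      have i1 : ∀ (χ : DirichletCharacter ℂ q) (u : (ZMod q)ˣ),
          χ (u⁻¹ : (ZMod q)ˣ) = χ⁻¹ u := fun χ u => by
        rw [MulChar.inv_apply, Ring.inverse_unit]
      have i2 : ∀ (χ : DirichletCharacter ℂ q) (u : (ZMod q)ˣ), χ u * χ⁻¹ u = 1 := fun χ u => by
        rw [← MulChar.mul_apply, mul_inv_cancel, MulChar.one_apply u.isUnit]
      rw [e1, e2, Units.val_mul]
      simp only [map_mul, MulChar.mul_apply, i1, mul_inv, inv_inv]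
      linear_combination (-A₀ a * A₀⁻¹ (a - 1) * B₁⁻¹ b * B₂⁻¹ a * A₂ b *
        (A₁⁻¹ (1 - b) * B₁ (1 - b)) * (A₂⁻¹ (b - a) * B₂ (b - a))) *
        (i2 A₂ a * (A₁ b * A₁⁻¹ b) + i2 A₁ b)
    · rw [MulChar.map_nonunit (A₂ * B₁⁻¹) hb]
      ring
  · simp only [MulChar.map_nonunit (A₀ * B₂⁻¹) ha, zero_mul, Finset.sum_const_zero]

end Hypergeometric

/-! ### Cliques and ordered cliques. -/

section CliqueCount

theorem card_ordered_cliques {V : Type*} [Fintype V] (G : SimpleGraph V) (n : ℕ) :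
    Nat.card {v : Fin n → V // ∀ i j, i ≠ j → G.Adj (v i) (v j)} =
      n.factorial * (G.cliqueSet n).ncard := by
  classical
  have hinj : ∀ v : Fin n → V, (∀ i j, i ≠ j → G.Adj (v i) (v j)) → Function.Injective v :=
    fun v hv i j hij => by
      by_contra h
      exact (hv i j h).ne hij
  rw [← SimpleGraph.coe_cliqueFinset, Set.ncard_coe_finset, Nat.card_eq_fintype_card,
    Fintype.card_subtype, mul_comm]
  rw [Finset.card_eq_sum_card_fiberwise (f := fun v : Fin n → V => Finset.univ.image v)
    (t := G.cliqueFinset n)]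
  · refine Finset.sum_const_nat fun s hs => ?_
    rw [SimpleGraph.mem_cliqueFinset_iff, SimpleGraph.isNClique_iff] at hs
    have hcard : Fintype.card (Fin n ≃ s) = n.factorial := by
      rw [Fintype.card_equiv (Fintype.equivOfCardEq (by simp [hs.2])), Fintype.card_fin]
    rw [← hcard, ← Finset.card_univ]
    symm
    refine Finset.card_bij (fun e _ i => (e i : V)) ?_ ?_ ?_
    · intro e _
      simp only [Finset.mem_filter, Finset.mem_univ, true_and]
      refine ⟨fun i j hij => hs.1 (e i).2 (e j).2 fun h => hij (e.injective (Subtype.ext h)), ?_⟩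
      ext x
      simp only [Finset.mem_image, Finset.mem_univ, true_and]
      exact ⟨fun ⟨i, hi⟩ => hi ▸ (e i).2, fun hx => ⟨e.symm ⟨x, hx⟩, by simp⟩⟩
    · intro e _ e' _ h
      exact Equiv.ext fun i => Subtype.ext (congrFun h i)
    · intro v hv
      simp only [Finset.mem_filter, Finset.mem_univ, true_and] at hv
      have hmem : ∀ i, v i ∈ s := fun i => hv.2 ▸ Finset.mem_image_of_mem v (Finset.mem_univ i)
      refine ⟨Equiv.ofBijective (fun i => (⟨v i, hmem i⟩ : s)) ⟨fun i j hij =>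
        hinj v hv.1 (congrArg Subtype.val hij), fun x => ?_⟩, Finset.mem_univ _, rfl⟩
      have hx : (x : V) ∈ Finset.univ.image v := hv.2.symm ▸ x.2
      obtain ⟨i, -, hi⟩ := Finset.mem_image.1 hx
      exact ⟨i, Subtype.ext hi⟩
  · intro v hv
    simp only [Finset.coe_filter, Finset.mem_univ, true_and, Set.mem_ofPred_eq] at hv
    simp only [Finset.mem_coe, SimpleGraph.mem_cliqueFinset_iff, SimpleGraph.isNClique_iff]
    refine ⟨?_, by rw [Finset.card_image_of_injective _ (hinj v hv), Finset.card_univ,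
      Fintype.card_fin]⟩
    intro x hx y hy hxy
    simp only [Finset.coe_image, Finset.coe_univ, Set.image_univ, Set.mem_range] at hx hy
    obtain ⟨i, rfl⟩ := hx
    obtain ⟨j, rfl⟩ := hy
    exact hv i j fun h => hxy (h ▸ rfl)

theorem twentyfour_mul_card_four_cliques {R : Type*} [CommRing R] [Fintype R] (G : SimpleGraph R)
    (s : R → ℂ) (h1 : ∀ x y, G.Adj x y → s (x - y) = 1) (h0 : ∀ x y, ¬G.Adj x y → s (x - y) = 0) :
    24 * ((G.cliqueSet 4).ncard : ℂ) = ∑ a, ∑ b, ∑ x, ∑ y,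
      s (a - b) * s (a - x) * s (a - y) * s (b - x) * s (b - y) * s (x - y) := by
  classical
  have h := card_ordered_cliques G 4
  have hs : ∀ x y, s (x - y) = if G.Adj x y then 1 else 0 := fun x y => by
    split_ifs with hxy
    exacts [h1 x y hxy, h0 x y hxy]
  have hiff : ∀ v : Fin 4 → R, (∀ i j, i ≠ j → G.Adj (v i) (v j)) ↔
      G.Adj (v 0) (v 1) ∧ G.Adj (v 0) (v 2) ∧ G.Adj (v 0) (v 3) ∧ G.Adj (v 1) (v 2) ∧
        G.Adj (v 1) (v 3) ∧ G.Adj (v 2) (v 3) := by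
    intro v
    simp only [Fin.forall_fin_succ]
    simp [G.adj_comm (v 1) (v 0), G.adj_comm (v 2) (v 0), G.adj_comm (v 3) (v 0),
      G.adj_comm (v 2) (v 1), G.adj_comm (v 3) (v 1), G.adj_comm (v 3) (v 2)]
    tauto
  rw [Nat.card_eq_fintype_card, Fintype.card_subtype] at h
  have h' := congrArg (Nat.cast : ℕ → ℂ) h
  rw [Finset.natCast_card_filter, Nat.cast_mul] at h'
  rw [show (24 : ℂ) = ((Nat.factorial 4 : ℕ) : ℂ) by norm_num [Nat.factorial], ← h',
    ← sum_fin_four_eq fun a b x y : R =>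
      s (a - b) * s (a - x) * s (a - y) * s (b - x) * s (b - y) * s (x - y)]
  refine Finset.sum_congr rfl fun v _ => ?_
  simp only [hs, hiff, ← ite_and, ite_mul, one_mul, zero_mul, and_assoc]

end CliqueCount

/-! ### Reduction from p^(m+1) to p. -/

section Fibers

/-- Averaging over all translates by b and exchanging the sums avoids counting fibres. -/
theorem sum_comp_surjective {A B : Type*} [AddCommGroup A] [AddCommGroup B] [Fintype A] [Fintype B]
    (π : A →+ B) (hπ : Function.Surjective π) (f : B → ℂ) :
    (Fintype.card B : ℂ) * ∑ a, f (π a) = Fintype.card A * ∑ b, f b := by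
  obtain ⟨s, hs⟩ := hπ.hasRightInverse
  have h1 : ∀ b, ∑ a, f (π a) = ∑ a, f (π a + b) := fun b =>
    (Fintype.sum_equiv (Equiv.addRight (s b)) _ _ fun a => by simp [hs b]).symm
  have h2 : ∀ a, ∑ b, f (π a + b) = ∑ b, f b := fun a =>
    Fintype.sum_equiv (Equiv.addLeft (π a)) _ _ fun b => rfl
  calc (Fintype.card B : ℂ) * ∑ a, f (π a) = ∑ _b : B, ∑ a, f (π a) := by simp
    _ = ∑ b, ∑ a, f (π a + b) := Finset.sum_congr rfl fun b _ => h1 b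
    _ = ∑ a, ∑ b, f (π a + b) := Finset.sum_comm
    _ = Fintype.card A * ∑ b, f b := by simp [h2]

variable {p m : ℕ} [Fact p.Prime]

/-- The reduction map from `ℤ/p^(m+1)` to `ℤ/p`. -/
def primePowReduction (p m : ℕ) : ZMod (p ^ (m + 1)) →+* ZMod p :=
  ZMod.castHom (dvd_pow_self p m.succ_ne_zero) (ZMod p)

theorem sum_primePowReduction (f : ZMod p → ℂ) :
    ∑ x, f (primePowReduction p m x) = (p : ℂ) ^ m * ∑ x, f x := by
  have hp : (p : ℂ) ≠ 0 := Nat.cast_ne_zero.2 (Fact.out : p.Prime).ne_zero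
  have h := sum_comp_surjective (primePowReduction p m).toAddMonoidHom
    (ZMod.ringHom_surjective _) f
  rw [ZMod.card, ZMod.card, Nat.cast_pow] at h
  refine mul_left_cancel₀ hp ?_
  rw [← mul_assoc, ← pow_succ']
  exact h

theorem sum_primePowReduction₂ (f : ZMod p → ZMod p → ℂ) :
    ∑ x, ∑ y, f (primePowReduction p m x) (primePowReduction p m y) =
      (p : ℂ) ^ (2 * m) * ∑ x, ∑ y, f x y := by
  rw [Finset.sum_congr rfl fun x _ => sum_primePowReduction (f (primePowReduction p m x)),
    sum_primePowReduction fun a => (p : ℂ) ^ m * ∑ y, f a y, ← Finset.mul_sum]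
  ring

theorem sum_primePowReduction₄ (f : ZMod p → ZMod p → ZMod p → ZMod p → ℂ) :
    ∑ a, ∑ b, ∑ x, ∑ y, f (primePowReduction p m a) (primePowReduction p m b)
        (primePowReduction p m x) (primePowReduction p m y) =
      (p : ℂ) ^ (4 * m) * ∑ a, ∑ b, ∑ x, ∑ y, f a b x y := by
  rw [Finset.sum_congr rfl fun a _ => Finset.sum_congr rfl fun b _ =>
      sum_primePowReduction₂ (f (primePowReduction p m a) (primePowReduction p m b)),
    sum_primePowReduction₂ fun a b => (p : ℂ) ^ (2 * m) * ∑ x, ∑ y, f a b x y]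
  simp only [← Finset.mul_sum]
  ring

theorem isUnit_primePowReduction {x : ZMod (p ^ (m + 1))} :
    IsUnit (primePowReduction p m x) ↔ IsUnit x := by
  obtain ⟨n, rfl⟩ := ZMod.natCast_zmod_surjective x
  rw [map_natCast, ZMod.isUnit_iff_coprime, ZMod.isUnit_iff_coprime,
    Nat.coprime_pow_right_iff m.succ_pos]

/-- The kernel of reduction on units has order p^m, so χ takes values there whose order divides both
p^m and the order of χ. -/
theorem exists_mulChar_of_coprime_order (χ : DirichletCharacter ℂ (p ^ (m + 1)))
    (hχ : (orderOf χ).Coprime p) :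
    ∃ ψ : MulChar (ZMod p) ℂ, orderOf ψ = orderOf χ ∧
      ∀ x, χ x = ψ (primePowReduction p m x) := by
  have hdvd : p ∣ p ^ (m + 1) := dvd_pow_self p m.succ_ne_zero
  have hprime : p.Prime := Fact.out
  have hfac : χ.FactorsThrough p := by
    rw [DirichletCharacter.factorsThrough_iff_ker_unitsMap hdvd]
    intro u hu
    have hcard : Nat.card (ZMod.unitsMap hdvd).ker = p ^ m := by
      have h1 := Subgroup.card_mul_index (ZMod.unitsMap hdvd).ker
      rw [Subgroup.index_ker, MonoidHom.range_eq_top.2 (ZMod.unitsMap_surjective hdvd),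
        Subgroup.card_top, Nat.card_eq_fintype_card (α := (ZMod p)ˣ),
        Nat.card_eq_fintype_card (α := (ZMod (p ^ (m + 1)))ˣ), ZMod.card_units_eq_totient,
        ZMod.card_units_eq_totient, Nat.totient_prime_pow_succ hprime,
        Nat.totient_prime hprime] at h1
      exact Nat.eq_of_mul_eq_mul_right (Nat.sub_pos_of_lt hprime.one_lt) h1
    have hupow : u ^ p ^ m = 1 := by
      have h := pow_card_eq_one' (x := (⟨u, hu⟩ : (ZMod.unitsMap hdvd).ker))
      rw [hcard] at h
      simpa using congrArg Subtype.val h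
    have hord : orderOf (χ.toUnitHom u) ∣ p ^ m :=
      orderOf_dvd_of_pow_eq_one (by rw [← map_pow, hupow, map_one])
    have hord' : orderOf (χ.toUnitHom u) ∣ orderOf χ := by
      refine orderOf_dvd_of_pow_eq_one (Units.ext ?_)
      rw [Units.val_pow_eq_pow_val, MulChar.coe_toUnitHom, ← MulChar.pow_apply_coe,
        pow_orderOf_eq_one, MulChar.one_apply u.isUnit, Units.val_one]
    have h1 := Nat.dvd_gcd hord' hord
    rw [(Nat.Coprime.pow_right m hχ).gcd_eq_one, Nat.dvd_one, orderOf_eq_one_iff] at h1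
    exact h1
  obtain ⟨h, ψ, rfl⟩ := hfac
  refine ⟨ψ, (orderOf_injective _ (DirichletCharacter.changeLevel_injective h) ψ).symm,
    fun x => ?_⟩
  by_cases hx : IsUnit x
  · obtain ⟨u, rfl⟩ := hx
    exact DirichletCharacter.changeLevel_eq_cast_of_dvd _ _ _
  · rw [MulChar.map_nonunit _ hx, MulChar.map_nonunit _ (isUnit_primePowReduction.not.2 hx)]

end Fibers

/-! ### The duplication formula for a quartic Jacobi sum. -/

section JacobiSumDuplication

variable {F : Type*} [Field F] [Fintype F] {χ : MulChar F ℂ}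

theorem quadraticChar_eq_mulChar_sq [DecidableEq F] (h4 : χ ^ 4 = 1) {t : F}
    (ht : χ t ^ 2 = -1) (s : F) : (quadraticChar F s : ℂ) = χ s * χ s := by
  have hsq : ∀ s : F, s ≠ 0 → IsSquare s → χ s * χ s = 1 := by
    rintro _ hs ⟨r, rfl⟩
    have hr : r ≠ 0 := left_ne_zero_of_mul hs
    rw [map_mul, ← mulChar_pow_four_apply h4 hr]
    ring
  have ht0 : t ≠ 0 := by
    rintro rfl
    simp [MulChar.map_zero] at ht
  have htns : quadraticChar F t = -1 := by
    rw [quadraticChar_neg_one_iff_not_isSquare]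
    intro h
    have := hsq t ht0 h
    rw [← sq, ht] at this
    norm_num at this
  by_cases hs : s = 0
  · simp [hs, MulChar.map_zero]
  rcases quadraticChar_dichotomy hs with h | h
  · rw [h, hsq s hs ((quadraticChar_one_iff_isSquare hs).1 h)]
    norm_num
  · have h1 : IsSquare (s * t) := by
      rw [← quadraticChar_one_iff_isSquare (mul_ne_zero hs ht0), map_mul, h, htns]
      norm_num
    have h2 := hsq _ (mul_ne_zero hs ht0) h1
    rw [map_mul] at h2
    rw [h]
    push_cast
    linear_combination h2 - χ s * χ s * ht

/-- Complete the square, 4x(1 - x) = 1 - (2x - 1)², and count the square roots of s by 1 plus the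
quadratic character, which is χ². -/
theorem jacobiSum_self_eq (hF : ringChar F ≠ 2) (h4 : χ ^ 4 = 1) {t : F}
    (ht : χ t ^ 2 = -1) (hfour : χ 4 = 1) : jacobiSum χ χ = jacobiSum χ (χ ^ 2) := by
  classical
  have h1 : χ ≠ 1 := by
    rintro rfl
    have ht0 : t ≠ 0 := by
      rintro rfl
      simp [MulChar.map_zero] at ht
    rw [MulChar.one_apply (isUnit_iff_ne_zero.2 ht0)] at ht
    norm_num at ht
  have two : (2 : F) ≠ 0 := Ring.two_ne_zero hF
  have e1 : jacobiSum χ χ = ∑ t, χ (1 - t ^ 2) := by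
    rw [jacobiSum]
    refine Fintype.sum_equiv ((Equiv.mulLeft₀ 2 two).trans (Equiv.subRight 1)) _ _ fun x => ?_
    change _ = χ (1 - (2 * x - 1) ^ 2)
    rw [show 1 - (2 * x - 1) ^ 2 = 4 * (x * (1 - x)) by ring, map_mul, hfour, one_mul, map_mul]
  have e2 : ∑ t, χ (1 - t ^ 2) = ∑ s, (quadraticChar F s + 1 : ℂ) * χ (1 - s) := by
    rw [← Finset.sum_fiberwise Finset.univ (fun t : F => t ^ 2)]
    refine Finset.sum_congr rfl fun s _ => ?_
    have h := quadraticChar_card_sqrts hF s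
    rw [Set.toFinset_ofPred] at h
    rw [Finset.sum_congr rfl fun t ht => by rw [(Finset.mem_filter.1 ht).2], Finset.sum_const,
      nsmul_eq_mul]
    congr 1
    exact_mod_cast congrArg (Int.cast : ℤ → ℂ) h
  rw [e1, e2, jacobiSum_comm, jacobiSum]
  simp only [add_mul, one_mul, Finset.sum_add_distrib, sum_const_sub_left (fun x => χ x),
    MulChar.sum_eq_zero_of_ne_one h1, add_zero]
  refine Finset.sum_congr rfl fun s _ => ?_
  rw [quadraticChar_eq_mulChar_sq h4 ht, sq, MulChar.mul_apply]

end JacobiSumDuplication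

/-! ### Characters determined by a generator. -/

section Generator

variable {n : ℕ} {g : (ZMod n)ˣ} (hg : ∀ u : (ZMod n)ˣ, u ∈ Subgroup.zpowers g)

include hg in
theorem dirichletCharacter_eq_of_generator {χ ψ : DirichletCharacter ℂ n} (h : χ g = ψ g) :
    χ = ψ := by
  refine MulChar.ext fun u => ?_
  obtain ⟨k, rfl⟩ := Subgroup.mem_zpowers_iff.1 (hg u)
  have h' : χ.toUnitHom g = ψ.toUnitHom g := Units.ext (by simpa using h)
  have h'' : χ.toUnitHom (g ^ k) = ψ.toUnitHom (g ^ k) := by rw [map_zpow, map_zpow, h']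
  rw [← MulChar.coe_toUnitHom, ← MulChar.coe_toUnitHom, h'']

include hg in
theorem quartic_apply_generator_sq {χ : DirichletCharacter ℂ n} (hχ : orderOf χ = 4) :
    χ g ^ 2 = -1 := by
  have h4 : (χ g ^ 2) ^ 2 = 1 := by
    have h : χ ^ (2 * 2) = 1 := orderOf_dvd_iff_pow_eq_one.1 (by rw [hχ])
    rw [← pow_mul, ← MulChar.pow_apply_coe, h, MulChar.one_apply g.isUnit]
  have h2 : χ g ^ 2 ≠ 1 := by
    intro h
    have h1 : χ ^ 2 = 1 := dirichletCharacter_eq_of_generator hg (by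
      rw [MulChar.pow_apply_coe, h, MulChar.one_apply g.isUnit])
    have := orderOf_dvd_of_pow_eq_one h1
    rw [hχ] at this
    norm_num at this
  exact (mul_self_eq_one_iff.1 ((sq _).symm.trans h4)).resolve_left h2

include hg in
theorem quadratic_eq_quartic_sq {χ φ : DirichletCharacter ℂ n} (hχ : orderOf χ = 4)
    (hφ : orderOf φ = 2) : φ = χ ^ 2 := by
  refine dirichletCharacter_eq_of_generator hg ?_
  rw [MulChar.pow_apply_coe, quartic_apply_generator_sq hg hχ]
  have h2 : φ g ^ 2 = 1 := by
    rw [← MulChar.pow_apply_coe, ← hφ, pow_orderOf_eq_one, MulChar.one_apply g.isUnit]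
  refine (mul_self_eq_one_iff.1 ((sq _).symm.trans h2)).resolve_left fun h => ?_
  have h1 : φ = 1 := dirichletCharacter_eq_of_generator hg (by
    rw [h, MulChar.one_apply g.isUnit])
  rw [h1, orderOf_one] at hφ
  norm_num at hφ

theorem quartic_apply_zpowers {χ : DirichletCharacter ℂ n} (hχ : orderOf χ = 4)
    {u : (ZMod n)ˣ} (hu : u ∈ Subgroup.zpowers (g ^ 4)) : χ u = 1 := by
  obtain ⟨k, rfl⟩ := Subgroup.mem_zpowers_iff.1 hu
  have h : χ.toUnitHom (g ^ 4) = 1 := Units.ext (by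
    rw [map_pow, Units.val_pow_eq_pow_val, MulChar.coe_toUnitHom, ← MulChar.pow_apply_coe, ← hχ,
      pow_orderOf_eq_one, MulChar.one_apply g.isUnit, Units.val_one])
  have h' : χ.toUnitHom ((g ^ 4) ^ k) = 1 := by rw [map_zpow, h, one_zpow]
  rw [← MulChar.coe_toUnitHom, h', Units.val_one]

include hg in
theorem unit_cases (u : (ZMod n)ˣ) : ∃ w ∈ Subgroup.zpowers (g ^ 4),
    u = w ∨ u = g * w ∨ u = g ^ 2 * w ∨ u = g ^ 3 * w := by
  obtain ⟨k, rfl⟩ := Subgroup.mem_zpowers_iff.1 (hg u)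
  refine ⟨(g ^ 4) ^ (k / 4), Subgroup.mem_zpowers_iff.2 ⟨_, rfl⟩, ?_⟩
  have h : ∀ r : ℕ, k % 4 = r → g ^ k = g ^ r * (g ^ 4) ^ (k / 4) := by
    intro r hr
    rw [← zpow_natCast g r, ← zpow_natCast g 4, ← zpow_mul, ← zpow_add, ← hr]
    congr 1
    push_cast
    omega
  have hr : k % 4 = 0 ∨ k % 4 = 1 ∨ k % 4 = 2 ∨ k % 4 = 3 := by omega
  rcases hr with hr | hr | hr | hr
  · exact Or.inl (by simpa using h 0 hr)
  · exact Or.inr (Or.inl (by simpa using h 1 hr))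
  · exact Or.inr (Or.inr (Or.inl (h 2 hr)))
  · exact Or.inr (Or.inr (Or.inr (h 3 hr)))

include hg in
theorem mem_peisertConnectionSet_iff {χ : DirichletCharacter ℂ n} (hχ : orderOf χ = 4)
    (u : (ZMod n)ˣ) : (u : ZMod n) ∈ peisertConnectionSet g ↔ χ u = 1 ∨ χ u = χ g := by
  have hω := quartic_apply_generator_sq hg hχ
  constructor
  · rintro ⟨w, hw, h | h⟩
    · exact Or.inl (by rw [h, quartic_apply_zpowers hχ hw])
    · exact Or.inr (by rw [h, map_mul, quartic_apply_zpowers hχ hw, mul_one])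
  · intro h
    obtain ⟨w, hw, hu⟩ := unit_cases hg u
    have hw1 := quartic_apply_zpowers hχ hw
    have hne : χ g ≠ 0 := (g.isUnit.map χ).ne_zero
    rcases hu with rfl | rfl | rfl | rfl
    · exact ⟨u, hw, Or.inl rfl⟩
    · exact ⟨w, hw, Or.inr (by simp)⟩
    · exfalso
      simp only [Units.val_mul, Units.val_pow_eq_pow_val, map_mul, map_pow, hw1, mul_one, hω] at h
      rcases h with h | h
      · norm_num at h
      · rw [← h] at hω
        norm_num at hω
    · exfalso
      have h3 : χ g ^ 3 = -χ g := by linear_combination χ g * hω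
      simp only [Units.val_mul, Units.val_pow_eq_pow_val, map_mul, map_pow, hw1, mul_one, h3] at h
      rcases h with h | h
      · have : χ g = -1 := by linear_combination -h
        rw [this] at hω
        norm_num at hω
      · exact hne (by linear_combination -h / 2)

end Generator

theorem neg_one_mem_zpowers_pow_four {p α : ℕ} [Fact p.Prime] (hp : p % 8 = 1) (hα : 1 ≤ α)
    {g : (ZMod (p ^ α))ˣ} (hg : ∀ u : (ZMod (p ^ α))ˣ, u ∈ Subgroup.zpowers g) :
    (-1 : (ZMod (p ^ α))ˣ) ∈ Subgroup.zpowers (g ^ 4) := by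
  have hprime : p.Prime := Fact.out
  obtain ⟨k, hk⟩ := Subgroup.mem_zpowers_iff.1 (hg (-1))
  have hcard : orderOf g = Nat.totient (p ^ α) := by
    rw [orderOf_eq_card_of_forall_mem_zpowers hg, Nat.card_eq_fintype_card,
      ZMod.card_units_eq_totient]
  have h8 : 8 ∣ orderOf g := by
    rw [hcard, Nat.totient_prime_pow hprime hα]
    exact Dvd.dvd.mul_left (by omega) _
  have h1 : g ^ (k * 2) = 1 := by
    rw [zpow_mul, hk]
    simp
  have h2 : (8 : ℤ) ∣ k * 2 :=
    dvd_trans (by exact_mod_cast h8) (orderOf_dvd_iff_zpow_eq_one.2 h1)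
  obtain ⟨m, rfl⟩ : (4 : ℤ) ∣ k := by omega
  refine Subgroup.mem_zpowers_iff.2 ⟨m, ?_⟩
  rw [← hk, zpow_mul]
  norm_cast

/-! ### Complex conjugates of the character sums. -/

section Conjugation

variable {F : Type*} [Field F] [Fintype F] (χ : MulChar F ℂ)

theorem conj_triangleSum : (starRingEnd ℂ) (triangleSum χ) = triangleSum χ⁻¹ := by
  have h : ∀ (ψ : MulChar F ℂ) x, (starRingEnd ℂ) (ψ x) = ψ⁻¹ x := fun ψ x =>
    MulChar.star_apply' ψ x
  simp only [triangleSum, map_sum, map_mul, h]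

theorem conj_jacobiSum_self :
    (starRingEnd ℂ) (jacobiSum χ χ) = jacobiSum χ⁻¹ χ⁻¹ := by
  have h : ∀ (ψ : MulChar F ℂ) x, (starRingEnd ℂ) (ψ x) = ψ⁻¹ x := fun ψ x =>
    MulChar.star_apply' ψ x
  simp only [jacobiSum, map_sum, map_mul, h]

end Conjugation

/-- With ω = χ(g), the sign function is 1, 1, -1, -1 where χ is 1, ω, -1, -ω; nonunits reduce to 0.
-/
theorem peisert_indicator {p m : ℕ} [Fact p.Prime] {g : (ZMod (p ^ (m + 1)))ˣ}
    (hg : ∀ u : (ZMod (p ^ (m + 1)))ˣ, u ∈ Subgroup.zpowers g)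
    {χ : DirichletCharacter ℂ (p ^ (m + 1))} (hχ : orderOf χ = 4) {ψ : MulChar (ZMod p) ℂ}
    (hψ : ∀ x, χ x = ψ (primePowReduction p m x)) (z : ZMod (p ^ (m + 1))) :
    (z ∈ peisertConnectionSet g → (nonzeroInd (primePowReduction p m z) +
      quarticSign ψ (χ g) (primePowReduction p m z)) / 2 = 1) ∧
    (z ∉ peisertConnectionSet g → (nonzeroInd (primePowReduction p m z) +
      quarticSign ψ (χ g) (primePowReduction p m z)) / 2 = 0) := by
  by_cases hz : IsUnit z
  · obtain ⟨u, rfl⟩ := hz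
    have hω := quartic_apply_generator_sq hg hχ
    have hu : primePowReduction p m (u : ZMod (p ^ (m + 1))) ≠ 0 :=
      (isUnit_primePowReduction.2 u.isUnit).ne_zero
    have h1 : nonzeroInd (primePowReduction p m (u : ZMod (p ^ (m + 1)))) = 1 := by
      simp [nonzeroInd, hu]
    have h2 := mulChar_mul_inv_apply (χ := ψ) hu
    rw [mem_peisertConnectionSet_iff hg hχ, hψ (u : ZMod (p ^ (m + 1))), h1, quarticSign]
    generalize ψ⁻¹ (primePowReduction p m (u : ZMod (p ^ (m + 1)))) = y at *
    have h3 : χ u = 1 ∨ χ u = χ g ∨ χ u = -1 ∨ χ u = -χ g := by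
      obtain ⟨w, hw, hu⟩ := unit_cases hg u
      have hw1 := quartic_apply_zpowers hχ hw
      have h3 : χ g ^ 3 = -χ g := by linear_combination χ g * hω
      rcases hu with rfl | rfl | rfl | rfl
      · exact Or.inl hw1
      · exact Or.inr (Or.inl (by simp [hw1]))
      · exact Or.inr (Or.inr (Or.inl (by simp [hw1, hω])))
      · exact Or.inr (Or.inr (Or.inr (by simp [hw1, h3])))
    rw [hψ (u : ZMod (p ^ (m + 1)))] at h3
    generalize ψ (primePowReduction p m (u : ZMod (p ^ (m + 1)))) = x at *
    generalize χ g = ω at *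
    constructor
    · rintro (h | h)
      · rw [h] at h2 ⊢
        linear_combination (1 + ω) / 4 * h2
      · rw [h] at h2 ⊢
        have hy : y = -ω := by linear_combination (-ω) * h2 + y * hω
        rw [hy]
        linear_combination -hω / 2
    · intro h
      rcases h3 with h3 | h3 | h3 | h3
      · exact absurd (Or.inl h3) h
      · exact absurd (Or.inr h3) h
      · rw [h3] at h2 ⊢
        linear_combination -(1 + ω) / 4 * h2
      · rw [h3] at h2 ⊢
        have hy : y = ω := by linear_combination ω * h2 + y * hω
        rw [hy]
        linear_combination hω / 2
  · have h0 : primePowReduction p m z = 0 := by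
      by_contra h
      exact hz (isUnit_primePowReduction.1 (isUnit_iff_ne_zero.2 h))
    refine ⟨?_, fun _ => by simp [h0, nonzeroInd, quarticSign, MulChar.map_zero]⟩
    rintro ⟨u, -, rfl | rfl⟩
    · exact absurd u.isUnit hz
    · exact absurd (g.isUnit.mul u.isUnit) hz

theorem theorem2 (p α : ℕ) [Fact p.Prime] (hp : p % 8 = 1) (hα : 1 ≤ α)
    (g : (ZMod (p ^ α))ˣ) (hg : ∀ u : (ZMod (p ^ α))ˣ, u ∈ Subgroup.zpowers g)
    (χ₄ φ : DirichletCharacter ℂ (p ^ α)) (hχ₄ : orderOf χ₄ = 4) (hφ : orderOf φ = 2)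
    (ρ ξ M₃ M₅ : ℂ)
    (hρ : ρ = jacobiSum χ₄ χ₄) (hξ : ξ = jacobiSum χ₄ φ)
    (hM₃ : M₃ = ((p ^ α : ℕ) : ℂ) ^ 2 * dirichletHypergeometric χ₄ ![χ₄⁻¹, χ₄⁻¹] ![φ, 1] 1)
    (hM₅ : M₅ = ((p ^ α : ℕ) : ℂ) ^ 2 * dirichletHypergeometric χ₄ ![χ₄, χ₄⁻¹] ![1, 1] 1) :
    (((peisertLikeGraph g).cliqueSet 4).ncard : ℂ) =
      (p : ℂ) ^ (2 * α - 1) * ((p : ℂ) - 1) / 3072 *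
        (2 * (p : ℂ) ^ (2 * α - 2) * ((p : ℂ) ^ 2 - 20 * (p : ℂ) + 81)
          + 2 * (ρ.im : ℂ) ^ 2 + 4 * (ρ.im : ℂ) * (ξ.im : ℂ)
          - (M₃.re : ℂ) + 3 * M₅) := by
  obtain ⟨m, rfl⟩ : ∃ m, α = m + 1 := ⟨α - 1, by omega⟩
  have hp2 : p ≠ 2 := by rintro rfl; norm_num at hp
  have hodd : p % 2 = 1 := by omega
  obtain ⟨ψ, hord, hψ⟩ := exists_mulChar_of_coprime_order χ₄ (by
    rw [hχ₄]
    exact Nat.Coprime.pow_left 2 (Nat.coprime_two_left.2 (Nat.odd_iff.2 hodd)))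
  rw [hχ₄] at hord
  have h4 : ψ ^ 4 = 1 := by rw [← hord, pow_orderOf_eq_one]
  have h2 : ψ ^ 2 ≠ 1 := fun h => by
    have := orderOf_dvd_of_pow_eq_one h
    rw [hord] at this
    norm_num at this
  have hω := quartic_apply_generator_sq hg hχ₄
  have hφ' := quadratic_eq_quartic_sq hg hχ₄ hφ
  have ht : ψ (primePowReduction p m g) = χ₄ g := (hψ g).symm
  have hm : ψ (-1) = 1 := by
    have h := hψ ((-1 : (ZMod (p ^ (m + 1)))ˣ) : ZMod (p ^ (m + 1)))
    rw [quartic_apply_zpowers hχ₄ (neg_one_mem_zpowers_pow_four hp hα hg)] at h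
    simpa using h.symm
  have hswap : ∀ x y, ψ (x - y) = ψ (y - x) := fun x y => by rw [← mulChar_neg hm, neg_sub]
  have hswap_inv : ∀ x y, ψ⁻¹ (x - y) = ψ⁻¹ (y - x) := fun x y => by
    rw [← mulChar_inv_neg hm, neg_sub]
  -- As p ≡ 1 mod 8, 2 is a square s², so 4 = s⁴.
  have hfour : ψ 4 = 1 := by
    obtain ⟨s, hs⟩ := (ZMod.exists_sq_eq_two_iff hp2).2 (Or.inl hp)
    have htwo : (2 : ZMod p) ≠ 0 := Ring.two_ne_zero (by rwa [ZMod.ringChar_zmod_n])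
    have hs0 : s ≠ 0 := by
      rintro rfl
      exact htwo (by simpa using hs)
    rw [show (4 : ZMod p) = s ^ 4 by linear_combination (2 + s * s) * hs, map_pow,
      mulChar_pow_four_apply h4 hs0]
  have hψinv : ∀ x, χ₄⁻¹ x = ψ⁻¹ (primePowReduction p m x) := fun x => by
    rw [MulChar.inv_apply_eq_inv', MulChar.inv_apply_eq_inv', hψ]
  have hψsq : ∀ x, (χ₄ ^ 2) x = (ψ ^ 2) (primePowReduction p m x) := fun x => by
    rw [MulChar.pow_apply' _ two_ne_zero, MulChar.pow_apply' _ two_ne_zero, hψ]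
  have hρ' : ρ = (p : ℂ) ^ m * jacobiSum ψ ψ := by
    rw [hρ, jacobiSum, jacobiSum, ← sum_primePowReduction]
    simp only [hψ, map_sub, map_one]
  have hξ' : ξ = (p : ℂ) ^ m * jacobiSum ψ ψ := by
    rw [hξ, hφ', jacobiSum_self_eq (by rwa [ZMod.ringChar_zmod_n]) h4 (t := primePowReduction p m g)
      (by rw [ht, hω]) hfour, jacobiSum, jacobiSum, ← sum_primePowReduction]
    simp only [hψ, hψsq, map_sub, map_one]
  -- With χ³ = χ⁻¹, the five characters in the double sum for M₃ collapse to χ, χ, χ⁻¹, χ⁻¹, χ, the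
  -- pattern of `triangleSum`.
  have hcub : χ₄ * χ₄ ^ 2 = χ₄⁻¹ := by
    rw [eq_inv_iff_mul_eq_one, ← pow_succ', ← pow_succ]
    exact orderOf_dvd_iff_pow_eq_one.1 (by rw [hχ₄])
  have hcub' : χ₄⁻¹ * (χ₄ ^ 2)⁻¹ = χ₄ := by
    rw [← mul_inv, hcub, inv_inv]
  have hM₃' : M₃ = (p : ℂ) ^ (2 * m) * triangleSum ψ := by
    rw [hM₃, dirichletHypergeometric_three_two, triangleSum, ← sum_primePowReduction₂]
    refine Finset.sum_congr rfl fun a _ => Finset.sum_congr rfl fun b _ => ?_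
    rw [hφ', hcub', inv_inv, hcub, inv_one, mul_one, hψ, hψ, hψinv, hψinv, hψ]
    simp only [map_sub, map_one]
    rw [hswap_inv _ 1, hswap (primePowReduction p m b)]
  have hM₅' : M₅ = (p : ℂ) ^ (2 * m) * pathSum ψ := by
    rw [hM₅, dirichletHypergeometric_three_two, pathSum, ← sum_primePowReduction₂]
    refine Finset.sum_congr rfl fun a _ => Finset.sum_congr rfl fun b _ => ?_
    rw [inv_inv, inv_one, mul_one, mul_one, hψ, hψinv, hψinv, hψinv, hψ]
    simp only [map_sub, map_one]
    rw [hswap_inv _ 1, hswap (primePowReduction p m b)]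
  have hcount := twentyfour_mul_card_four_cliques (peisertLikeGraph g)
    (fun z => (nonzeroInd (primePowReduction p m z) +
      quarticSign ψ (χ₄ g) (primePowReduction p m z)) / 2)
    (fun x y hxy => (peisert_indicator hg hχ₄ hψ _).1 ((peisertLikeGraph_adj hp hα g hg x y).1 hxy))
    (fun x y hxy => (peisert_indicator hg hχ₄ hψ _).2
      fun h => hxy ((peisertLikeGraph_adj hp hα g hg x y).2 h))
  have hfield := sum_completeTerm_indicator hm h4 h2 hω ht
  rw [ZMod.card] at hfield
  simp only [map_sub] at hcount
  have hblow := sum_primePowReduction₄ (m := m)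
    (completeTerm (fun z : ZMod p => (nonzeroInd z + quarticSign ψ (χ₄ g) z) / 2))
  rw [hfield] at hblow
  simp only [completeTerm] at hblow
  rw [hblow] at hcount
  have hpow : ∀ k : ℕ, (starRingEnd ℂ) ((p : ℂ) ^ k) = (p : ℂ) ^ k := fun k => by
    rw [map_pow, Complex.conj_natCast]
  have hre : (M₃.re : ℂ) = (p : ℂ) ^ (2 * m) * (triangleSum ψ + triangleSum ψ⁻¹) / 2 := by
    rw [Complex.re_eq_add_conj, hM₃', map_mul, conj_triangleSum, hpow]
    ring
  have him : (ρ.im : ℂ) ^ 2 =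
      -((p : ℂ) ^ (2 * m) * (jacobiSum ψ ψ - jacobiSum ψ⁻¹ ψ⁻¹) ^ 2) / 4 := by
    rw [Complex.im_eq_sub_conj, hρ', map_mul, conj_jacobiSum_self, hpow, div_pow, mul_pow,
      Complex.I_sq]
    ring
  -- Here 3072 = 24 · 64 · 2: vertex orderings, six halves from the indicators, and the factor 2
  -- clearing the final half.
  rw [hξ'.trans hρ'.symm, hre, hM₅', show 2 * (m + 1) - 1 = 2 * m + 1 by omega,
    show 2 * (m + 1) - 2 = 2 * m by omega]
  linear_combination hcount / 24 - (p : ℂ) ^ (2 * m + 1) * ((p : ℂ) - 1) / 3072 * 6 * him
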